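/- Fix predicate names to be binary strings. A *graph* $G=(N_G,E_G,\mathrm{source}_G,\mathrm{target}_G,\mathrm{lab}_G,\mathrm{occur}_G)$ consists of finite sets of nodes $N_G$ and edges $E_G$, maps $\mathrm{source}_G,\mathrm{target}_G:E_G\to N_G$, a labelling $\mathrm{lab}_G$ of the edges by predicate names, and a map $\mathrm{occur}_G$ assigning to each edge an interval $[k;l]$ with $k\in\mathbb N$ and $k\le l\le\infty$. Parallel edges are allowed. Intervals are added by $[k_1;l_1]\oplus[k_2;l_2]=[k_1+k_2;l_1+l_2]$, the empty sum being $[0;0]$. A *shape graph* is a graph all of whose intervals are among the basic intervals $\mathtt 1=[1;1]$, $\mathtt ?=[0;1]$, $\mathtt +=[1;\infty]$, $\mathtt *=[0;\infty]$. Write $\mathrm{out}_G(n)=\{e\in E_G\mid \mathrm{source}_G(e)=n\}$. A relation $R\subseteq N_G\times N_H$ is a *simulation* of $G$ in $H$ if for every $(n,m)\in R$ there is a function $\lambda:\mathrm{out}_G(n)\to\mathrm{out}_H(m)$ such that 1. $\mathrm{lab}_G(e)=\mathrm{lab}_H(\lambda(e))$ for every $e\in\mathrm{out}_G(n)$, 2.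 $(\mathrm{target}_G(e),\mathrm{target}_H(\lambda(e)))\in R$ for every $e\in\mathrm{out}_G(n)$, 3. $\bigoplus_{e\in\mathrm{out}_G(n),\,\lambda(e)=f}\mathrm{occur}_G(e)\subseteq\mathrm{occur}_H(f)$ for every $f\in\mathrm{out}_H(m)$. An *embedding* of $G$ in $H$ is a simulation $R$ of $G$ in $H$ such that every node of $G$ is related by $R$ to some node of $H$; $G$ *can be embedded* in $H$ if an embedding exists. Encode a shape graph with nodes $0,\dots,p-1$ as a word over a finite alphabet: one tick per node, followed by the list of its edges, each edge being written as its source number, its interval, its label and its target number (node numbers as blocks of ticks, which is polynomially equivalent to binary because every node is listed). Encode a pair of shape graphs by the two encodings with a separator symbol in between. **Theorem.** The problem of testing the existence of embeddings between shape graphs is in $\mathrm P$: the language of all words that encode a pair $(G,H)$ of shape graphs such that $G$ can be embedded in $H$ is decided by a deterministic multi-stack Turing machine in time polynomial in the length of the input word. -/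

import Mathlib

namespace ShEx

/-- An occurrence interval `[lo; hi]` with `lo ≤ hi ≤ ∞`. -/
@[ext] structure Interval where
  lo : ℕ
  hi : ℕ∞
  lo_le_hi : (lo : ℕ∞) ≤ hi

namespace Interval

/-- The set of natural numbers represented by an interval. -/
def toSet (I : Interval) : Set ℕ := {i | I.lo ≤ i ∧ (i : ℕ∞) ≤ I.hi}

instance : HasSubset Interval := ⟨fun I J => I.toSet ⊆ J.toSet⟩

instance : Zero Interval := ⟨⟨0, 0, by simp⟩⟩

/-- `[n₁; m₁] ⊕ [n₂; m₂] = [n₁ + n₂; m₁ + m₂]`. -/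
instance : Add Interval :=
  ⟨fun I J => ⟨I.lo + J.lo, I.hi + J.hi, by
    push_cast; exact add_le_add I.lo_le_hi J.lo_le_hi⟩⟩

instance : AddCommMonoid Interval where
  add_assoc I J K := Interval.ext (add_assoc _ _ _) (add_assoc _ _ _)
  zero_add I := Interval.ext (zero_add _) (zero_add _)
  add_zero I := Interval.ext (add_zero _) (add_zero _)
  add_comm I J := Interval.ext (add_comm _ _) (add_comm _ _)
  nsmul := nsmulRec

/-- Inclusion of intervals is the expected comparison of end points. -/
theorem subset_iff (I J : Interval) : I ⊆ J ↔ J.lo ≤ I.lo ∧ I.hi ≤ J.hi := by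
  constructor
  · intro h
    have h0 : I.lo ∈ J.toSet := h ⟨le_rfl, I.lo_le_hi⟩
    refine ⟨h0.1, ?_⟩
    refine ENat.forall_natCast_le_iff_le.mp fun a ha => ?_
    rcases le_total I.lo a with hl | hl
    · exact (h (show a ∈ I.toSet from ⟨hl, ha⟩)).2
    · exact le_trans (by exact_mod_cast hl) h0.2
  · rintro ⟨h1, h2⟩ i hi
    exact ⟨h1.trans hi.1, hi.2.trans h2⟩

end Interval

/-- The four basic intervals `1 = [1;1]`, `? = [0;1]`, `+ = [1;∞]`, `* = [0;∞]`. -/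
inductive Basic
  | one
  | opt
  | plus
  | star

/-- The interval denoted by a basic interval. -/
def Basic.toInterval : Basic → Interval
  | .one => ⟨1, 1, by simp⟩
  | .opt => ⟨0, 1, by simp⟩
  | .plus => ⟨1, ⊤, by simp⟩
  | .star => ⟨0, ⊤, by simp⟩

/-- Directed multigraphs with node set `N` and edge set `E`, whose edges carry a predicate
label in `Sig` and an occurrence interval. -/
structure Graph (Sig N E : Type) where
  source : E → N
  target : E → N
  lab : E → Sig
  occur : E → Interval

namespace Graph

variable {Sig N E N' E' : Type}

/-- The outgoing edges of a node. -/
abbrev Out (G : Graph Sig N E) (n : N) : Type := {e : E // G.source e = n}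

/-- A shape graph uses only basic intervals. -/
def IsShapeGraph (G : Graph Sig N E) : Prop := ∀ e, ∃ M : Basic, G.occur e = M.toInterval

open Classical in
/-- The function `w` is a witness of simulation of `n` by `m` with respect to `R`. -/
def IsWitness [Fintype E] (G : Graph Sig N E) (H : Graph Sig N' E') (R : N → N' → Prop)
    (n : N) (m : N') (w : G.Out n → H.Out m) : Prop :=
  (∀ e, G.lab e.1 = H.lab (w e).1) ∧
  (∀ e, R (G.target e.1) (H.target (w e).1)) ∧
  (∀ f : H.Out m, (∑ e : G.Out n with w e = f, G.occur e.1) ⊆ H.occur f.1)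

/-- The relation `R` is a simulation of `G` in `H`. -/
def IsSimulation [Fintype E] (G : Graph Sig N E) (H : Graph Sig N' E')
    (R : N → N' → Prop) : Prop :=
  ∀ n m, R n m → ∃ w : G.Out n → H.Out m, G.IsWitness H R n m w

/-- An embedding is a simulation whose domain is the whole node set of `G`. -/
def IsEmbedding [Fintype E] (G : Graph Sig N E) (H : Graph Sig N' E')
    (R : N → N' → Prop) : Prop :=
  G.IsSimulation H R ∧ ∀ n, ∃ m, R n m

/-- `G` can be embedded in `H`. -/
def Embeds [Fintype E] (G : Graph Sig N E) (H : Graph Sig N' E') : Prop :=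
  ∃ R : N → N' → Prop, G.IsEmbedding H R

end Graph

/-- An explicitly presented finite shape graph: nodes and edges are numbered, predicate names
are binary strings. -/
structure ShapeGraph where
  numNodes : ℕ
  numEdges : ℕ
  source : Fin numEdges → Fin numNodes
  target : Fin numEdges → Fin numNodes
  lab : Fin numEdges → List Bool
  occ : Fin numEdges → Basic

/-- The graph presented by `G`. -/
def ShapeGraph.toGraph (G : ShapeGraph) :
    Graph (List Bool) (Fin G.numNodes) (Fin G.numEdges) where
  source := G.source
  target := G.target
  lab := G.lab
  occur e := (G.occ e).toInterval

theorem ShapeGraph.isShapeGraph_toGraph (G : ShapeGraph) : G.toGraph.IsShapeGraph :=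
  fun e => ⟨G.occ e, rfl⟩

/-- Up to the names of its nodes and edges, every finite shape graph has a presentation. -/
theorem Graph.IsShapeGraph.exists_presentation {N E : Type} [Finite N] [Finite E]
    {G : Graph (List Bool) N E} (hG : G.IsShapeGraph) :
    ∃ (C : ShapeGraph) (a : N ≃ Fin C.numNodes) (b : E ≃ Fin C.numEdges), ∀ e,
      C.toGraph.source (b e) = a (G.source e) ∧ C.toGraph.target (b e) = a (G.target e) ∧
      C.toGraph.lab (b e) = G.lab e ∧ C.toGraph.occur (b e) = G.occur e := by
  choose o ho using hG
  let a := Finite.equivFin N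
  let b := Finite.equivFin E
  exact ⟨⟨Nat.card N, Nat.card E, fun i => a (G.source (b.symm i)),
    fun i => a (G.target (b.symm i)), fun i => G.lab (b.symm i), fun i => o (b.symm i)⟩, a, b,
    fun e => by simp [ShapeGraph.toGraph, ho]⟩

/-- The finite input alphabet. -/
inductive Sym
  | tick
  | edge
  | sep
  | bit (b : Bool)
  | occ (M : Basic)

/-- An edge is written as its source number (as a block of ticks), its occurrence interval, its
label and its target number (as a block of ticks). -/
def ShapeGraph.encodeEdge (G : ShapeGraph) (e : Fin G.numEdges) : List Sym :=
  Sym.edge :: List.replicate (G.source e) Sym.tick ++ Sym.occ (G.occ e) ::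
    (G.lab e).map Sym.bit ++ List.replicate (G.target e) Sym.tick

/-- A shape graph is written as one tick for each of its nodes, followed by the list of its
edges. -/
def ShapeGraph.encode (G : ShapeGraph) : List Sym :=
  List.replicate G.numNodes Sym.tick ++ (List.ofFn G.encodeEdge).flatten

/-- The embedding problem for shape graphs: the set of all words that encode a pair `(G, H)` of
shape graphs such that `G` can be embedded in `H`. -/
def embeddingProblem : Language Sym :=
  {x | ∃ G H : ShapeGraph, x = G.encode ++ Sym.sep :: H.encode ∧ G.toGraph.Embeds H.toGraph}

open Classical in
/-- The class P: the characteristic function of the language `L`, defined on all words, is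
computed by a (multi-stack) Turing machine in time polynomial in the length of the word. -/
def InP {A : Type} (L : Language A) : Prop :=
  Nonempty (Turing.TM2ComputableInPolyTime (id : List A → List A) Computability.encodeBool
    (fun x => decide (x ∈ L)))

end ShEx

/-! Simulations of `G` in `H` have a greatest element, and `G` embeds in `H` exactly when every node
of `G` occurs in it. It is found by pruning: start from all pairs of nodes and repeatedly discard
the pairs that have no witness with respect to the current relation. Each effective round removes a
pair, so as many rounds as there are pairs suffice (`prune_fixed`). A witness for a relation is also
one for every larger relation, so no pair of a simulation is ever discarded
(`ShapeGraph.embeds_data_iff`).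

It remains to decide whether one pair of nodes has a witness. For basic intervals, the condition on
the edges mapped to `f` says that a required `f` receives a required edge and that a bounded `f`
receives at most one edge, itself bounded (`sum_toInterval_subset_iff`). So at most one edge of each
fibre matters: the only one over a bounded `f`, a required one over `+`, none over `*`. All other
edges only need some unbounded edge to go to. Matching the distinguished edges with their images,
and letting the other edges of either side be matched with themselves where this is harmless, turns
witnesses into perfect matchings of the disjoint union of the two sets of edges
(`exists_witness_iff`).

Perfect matchings are found by an auction. A bidder without an item bids for a cheapest admissible
item, whose price rises by one, and displaces the previous owner. An owner's item is thus always
within one of the cheapest for that owner. If a perfect matching exists, a Hall-type counting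
argument shows that an unassigned bidder still has an admissible item of price below the number `n`
of bidders (`Auction.Inv.exists_price_lt`). Hence there are at most `n * n` bids, and the auction
ends with everybody served (`Auction.perfect_iff`).

For the running time, data are coded by binary trees written in preorder on a stack. `PolyTime` is
the class of functions on codes computed in polynomial time by structured stack programs. It is
closed under composition, pairing, case distinction and iteration with polynomially bounded
intermediate values (`PolyTime.iterate_length`), hence under bounded folds, `map` and `filter`,
which covers the whole procedure. Structured programs compile to Turing machines without loss of
time (`Cmd.evals_of_exec`, `PolyTime.inP`). -/

/-! ### A structured language for stack machines -/

namespace StackLang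

open Function Turing StateTransition

/-- Structured programs over a family of stacks. `loop k p cont` pops a symbol `o` from the stack
`k`, executes `p o`, and starts again if `cont o` holds. -/
inductive Cmd {K : Type} (Γ : K → Type) : Type
  | skip : Cmd Γ
  | push (k : K) (a : Γ k) : Cmd Γ
  | seq (p q : Cmd Γ) : Cmd Γ
  | loop (k : K) (p : Option (Γ k) → Cmd Γ) (cont : Option (Γ k) → Bool) : Cmd Γ

variable {K : Type} [DecidableEq K] {Γ : K → Type}

/-- `Exec c s s' t`: started with the stacks `s`, the program `c` halts with the stacks `s'` after
at most `t` steps. -/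
inductive Exec : Cmd Γ → (∀ k, List (Γ k)) → (∀ k, List (Γ k)) → ℕ → Prop
  | skip (s) : Exec .skip s s 1
  | push (k a s) : Exec (.push k a) s (update s k (a :: s k)) 1
  | seq {p q s s' s'' t t'} : Exec p s s' t → Exec q s' s'' t' → Exec (.seq p q) s s'' (t + t')
  | last {k p cont s s' t} : cont (s k).head? = false →
      Exec (p (s k).head?) (update s k (s k).tail) s' t → Exec (.loop k p cont) s s' (t + 1)
  | next {k p cont s s' s'' t t'} : cont (s k).head? = true →
      Exec (p (s k).head?) (update s k (s k).tail) s' t →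
      Exec (.loop k p cont) s' s'' t' → Exec (.loop k p cont) s s'' (t + t' + 1)
  | mono {c s s' t t'} : Exec c s s' t → t ≤ t' → Exec c s s' t'

namespace Cmd

/-- The control points of a program. -/
def Lbl : Cmd Γ → Type
  | skip => Unit
  | push _ _ => Unit
  | seq p q => p.Lbl ⊕ q.Lbl
  | loop k p _ => Unit ⊕ (Σ o : Option (Γ k), (p o).Lbl)

/-- The control point at which a program starts. -/
def entry : (c : Cmd Γ) → c.Lbl
  | skip => ()
  | push _ _ => ()
  | seq p _ => Sum.inl p.entry
  | loop _ _ _ => Sum.inl ()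

instance finite_Lbl [∀ k, Finite (Γ k)] : (c : Cmd Γ) → Finite c.Lbl
  | skip => inferInstanceAs (Finite Unit)
  | push _ _ => inferInstanceAs (Finite Unit)
  | seq p q =>
    have := finite_Lbl p
    have := finite_Lbl q
    inferInstanceAs (Finite (p.Lbl ⊕ q.Lbl))
  | loop k p _ =>
    have := fun o => finite_Lbl (p o)
    inferInstanceAs (Finite (Unit ⊕ (Σ o : Option (Γ k), (p o).Lbl)))

/-- The statement of the stack machine at a control point, where `emb` embeds the control points
into the labels of the machine and `exit` is the label at which the machine continues. The local
variable of the machine holds for each stack the symbol popped last. -/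
def code {Λ : Type} : (c : Cmd Γ) → (c.Lbl → Λ) → Λ → c.Lbl → TM2.Stmt Γ Λ (∀ k, Option (Γ k))
  | skip, _, exit, _ => .goto fun _ => exit
  | push k a, _, exit, _ => .push k (fun _ => a) (.goto fun _ => exit)
  | seq p q, emb, exit, l => Sum.rec (fun l => p.code (emb ∘ .inl) (emb (.inr q.entry)) l)
      (fun l => q.code (emb ∘ .inr) exit l) l
  | loop k p cont, emb, exit, l => Sum.rec
      (fun _ => .pop k (fun v o => update v k o) (.goto fun v => emb (.inr ⟨v k, (p (v k)).entry⟩)))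
      (fun l => (p l.1).code (fun l' => emb (.inr ⟨l.1, l'⟩))
        (if cont l.1 then emb (.inl ()) else exit) l.2) l

variable {Λ : Type}

/-- The stack machine executes a program with the running time of the program. -/
theorem evals_of_exec {M : Λ → TM2.Stmt Γ Λ (∀ k, Option (Γ k))} {c : Cmd Γ}
    {s s' : ∀ k, List (Γ k)} {t : ℕ} (h : Exec c s s' t) {emb : c.Lbl → Λ} {exit : Λ}
    (hM : ∀ l, M (emb l) = c.code emb exit l) (v : ∀ k, Option (Γ k)) :
    ∃ v', Nonempty (EvalsToInTime (TM2.step M) ⟨some (emb c.entry), v, s⟩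
      (some ⟨some exit, v', s'⟩) t) := by
  -- The exit varies with the subprogram: the first half of `seq` leaves at the entry of the second
  -- half, and the body of a continuing loop leaves at the head of the loop.
  induction h generalizing exit v with
  | skip s =>
    refine ⟨v, ⟨⟨1, ?_⟩, le_rfl⟩⟩
    simp [flip, hM, code]
  | push k a s =>
    refine ⟨v, ⟨⟨1, ?_⟩, le_rfl⟩⟩
    simp [flip, hM, code]
  | @seq p q s s' s'' t t' _ _ ih₁ ih₂ =>
    obtain ⟨v₁, ⟨h₁⟩⟩ := ih₁ (emb := emb ∘ .inl) (exit := emb (.inr q.entry))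
      (fun l => hM (.inl l)) v
    obtain ⟨v₂, ⟨h₂⟩⟩ := ih₂ (emb := emb ∘ .inr) (exit := exit) (fun l => hM (.inr l)) v₁
    refine ⟨v₂, ⟨?_⟩⟩
    rw [add_comm]
    exact h₁.trans _ _ _ _ _ _ h₂
  | @last k p cont s s' t hc _ ih =>
    obtain ⟨v₁, ⟨h₁⟩⟩ := ih (emb := fun l => emb (.inr ⟨_, l⟩)) (exit := exit)
      (fun l => by simpa [code, hc] using hM (.inr ⟨_, l⟩)) (update v k (s k).head?)
    refine ⟨v₁, ⟨?_⟩⟩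
    refine EvalsToInTime.trans _ 1 t _ _ _ ⟨⟨1, ?_⟩, le_rfl⟩ h₁
    have := hM (.inl ())
    simp only [code] at this
    simp only [flip, entry, this, iterate_one, Option.bind_eq_bind, Option.bind_some, TM2.step,
      TM2.stepAux]
    rw [update_self]
  | @next k p cont s s' s'' t t' hc _ _ ih₁ ih₂ =>
    obtain ⟨v₁, ⟨h₁⟩⟩ := ih₁ (emb := fun l => emb (.inr ⟨_, l⟩)) (exit := emb (.inl ()))
      (fun l => by simpa [code, hc] using hM (.inr ⟨_, l⟩)) (update v k (s k).head?)
    obtain ⟨v₂, ⟨h₂⟩⟩ := ih₂ hM v₁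
    refine ⟨v₂, ⟨?_⟩⟩
    rw [show t + t' + 1 = t' + (t + 1) by ring]
    refine EvalsToInTime.trans _ (t + 1) t' _ _ _ ?_ h₂
    refine EvalsToInTime.trans _ 1 t _ _ _ ⟨⟨1, ?_⟩, le_rfl⟩ h₁
    have := hM (.inl ())
    simp only [code] at this
    simp only [flip, entry, this, iterate_one, Option.bind_eq_bind, Option.bind_some, TM2.step,
      TM2.stepAux]
    rw [update_self]
  | mono _ hle ih =>
    obtain ⟨v₁, ⟨h₁⟩⟩ := ih hM v
    exact ⟨v₁, ⟨⟨h₁.1, h₁.2.trans hle⟩⟩⟩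

end Cmd

end StackLang

/-! ### Binary trees on a stack -/

/-- Binary trees, used as a universal data type. -/
inductive BinTree
  | nil : BinTree
  | node (a b : BinTree) : BinTree

namespace BinTree

/-- The preorder traversal, a prefix code for binary trees. -/
def word : BinTree → List Bool
  | nil => [false]
  | node a b => true :: (a.word ++ b.word)

/-- The number of vertices and leaves. -/
def size : BinTree → ℕ
  | nil => 1
  | node a b => a.size + b.size + 1

@[simp] theorem length_word (d : BinTree) : d.word.length = d.size := by
  induction d with
  | nil => rfl
  | node a b iha ihb => simp [word, size, iha, ihb]

/-- The remainders `u` and `v` carry the induction through `node`: after the first subtree, the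
second one is part of the remainder. -/
theorem word_append_inj {a b : BinTree} {u v : List Bool} (h : a.word ++ u = b.word ++ v) :
    a = b ∧ u = v := by
  induction a generalizing b u v with
  | nil => cases b <;> simp_all [word]
  | node a₁ a₂ ih₁ ih₂ =>
    cases b with
    | nil => simp [word] at h
    | node b₁ b₂ =>
      simp only [word, List.cons_append, List.append_assoc, List.cons.injEq, true_and] at h
      obtain ⟨rfl, h'⟩ := ih₁ h
      obtain ⟨rfl, rfl⟩ := ih₂ h'
      simp

theorem word_injective : Function.Injective word := fun a b h =>
  (word_append_inj (u := []) (v := []) (by simpa using h)).1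

end BinTree

/-! ### The stacks of the machine, and programs that move trees between them. -/

namespace StackLang

open Function Turing StateTransition

/-- The stacks: an input stack, a main stack, two auxiliary stacks and a counter. -/
inductive Stk
  | inp
  | main
  | auxA
  | auxB
  | cnt
  deriving DecidableEq

instance : Finite Stk :=
  Finite.of_surjective (fun i : Fin 5 => match i with
    | 0 => Stk.inp | 1 => .main | 2 => .auxA | 3 => .auxB | 4 => .cnt)
    fun s => by cases s <;> [use 0; use 1; use 2; use 3; use 4]

/-- The stack alphabets. -/
abbrev Alph (A : Type) : Stk → Type
  | .inp => A
  | _ => Bool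

variable {A : Type}

/-- The stack contents, listed. -/
def st (i : List A) (m a b c : List Bool) : ∀ k, List (Alph A k)
  | .inp => i
  | .main => m
  | .auxA => a
  | .auxB => b
  | .cnt => c

section st
variable (i : List A) (m a b c : List Bool)

@[simp] theorem st_inp : st i m a b c .inp = i := rfl
@[simp] theorem st_main : st i m a b c .main = m := rfl
@[simp] theorem st_auxA : st i m a b c .auxA = a := rfl
@[simp] theorem st_auxB : st i m a b c .auxB = b := rfl
@[simp] theorem st_cnt : st i m a b c .cnt = c := rfl
@[simp] theorem update_st_inp (x : List A) : update (st i m a b c) .inp x = st x m a b c := by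
  funext k; cases k <;> rfl
@[simp] theorem update_st_main (x : List Bool) :
    update (st i m a b c) .main x = st i x a b c := by funext k; cases k <;> rfl
@[simp] theorem update_st_auxA (x : List Bool) :
    update (st i m a b c) .auxA x = st i m x b c := by funext k; cases k <;> rfl
@[simp] theorem update_st_auxB (x : List Bool) :
    update (st i m a b c) .auxB x = st i m a x c := by funext k; cases k <;> rfl
@[simp] theorem update_st_cnt (x : List Bool) :
    update (st i m a b c) .cnt x = st i m a b x := by funext k; cases k <;> rfl

end st

section rules
variable {K : Type} [DecidableEq K] {Γ : K → Type} {s s₁ s₂ s' : ∀ k, List (Γ k)} {t t' : ℕ}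

theorem Exec.push_of_eq {k : K} {a : Γ k} (h : update s k (a :: s k) = s') :
    Exec (.push k a) s s' 1 := h ▸ .push k a s

theorem Exec.last_of_eq {k : K} {p : Option (Γ k) → Cmd Γ} {cont} (o : Option (Γ k))
    (ho : (s k).head? = o) (hs : update s k (s k).tail = s₁) (hc : cont o = false)
    (h : Exec (p o) s₁ s' t) : Exec (.loop k p cont) s s' (t + 1) := by
  subst ho hs; exact .last hc h

theorem Exec.next_of_eq {k : K} {p : Option (Γ k) → Cmd Γ} {cont} (o : Option (Γ k))
    (ho : (s k).head? = o) (hs : update s k (s k).tail = s₁) (hc : cont o = true)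
    (h : Exec (p o) s₁ s₂ t) (h' : Exec (.loop k p cont) s₂ s' t') :
    Exec (.loop k p cont) s s' (t + t' + 1) := by
  subst ho hs; exact .next hc h h'

theorem Exec.mono' {c : Cmd Γ} (h : Exec c s s' t) (hs : s' = s₁) (ht : t ≤ t') :
    Exec c s s₁ t' := hs ▸ h.mono ht

/-- Pop a symbol and branch. -/
def Cmd.case (k : K) (p : Option (Γ k) → Cmd Γ) : Cmd Γ := .loop k p fun _ => false

theorem Exec.case {k : K} {p : Option (Γ k) → Cmd Γ} (o : Option (Γ k))
    (ho : (s k).head? = o) (hs : update s k (s k).tail = s₁)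
    (h : Exec (p o) s₁ s' t) : Exec (.case k p) s s' (t + 1) :=
  .last_of_eq o ho hs rfl h

/-- Pop a symbol. -/
def Cmd.pop (k : K) : Cmd Γ := .case k fun _ => .skip

theorem Exec.pop {k : K} (hs : update s k (s k).tail = s') : Exec (.pop k) s s' 2 :=
  .case _ rfl hs (.skip _)

/-- Execute `p b` for all symbols `b` popped from a stack. -/
def Cmd.each (k : K) (p : Γ k → Cmd Γ) : Cmd Γ :=
  .loop k (fun o => o.elim .skip p) Option.isSome

theorem Exec.each_nil {k : K} {p : Γ k → Cmd Γ} (h : s k = []) : Exec (.each k p) s s 2 :=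
  .last_of_eq none (by simp [h]) (by rw [h, List.tail_nil, ← h, update_eq_self]) rfl (.skip _)

theorem Exec.each_cons {k : K} {p : Γ k → Cmd Γ} {b : Γ k} {l : List (Γ k)} (h : s k = b :: l)
    (hs : update s k l = s₁) (hp : Exec (p b) s₁ s₂ t) (h' : Exec (.each k p) s₂ s' t') :
    Exec (.each k p) s s' (t + t' + 1) :=
  .next_of_eq (some b) (by simp [h]) (by rw [h, List.tail_cons, hs]) rfl hp h'

end rules

namespace Cmd

/-- Empty the first auxiliary stack. -/
def clearA : Cmd (Alph A) := .each .auxA fun _ => .skip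

theorem exec_clearA (i : List A) (m a b c : List Bool) :
    Exec clearA (st i m a b c) (st i m [] b c) (2 * a.length + 2) := by
  induction a with
  | nil => exact .each_nil rfl
  | cons x l ih =>
    exact (Exec.each_cons (b := x) rfl (update_st_auxA ..) (.skip _) ih).mono' rfl
      (by simp; omega)

/-- Move the content of the first auxiliary stack to the main stack. -/
def pourA : Cmd (Alph A) := .each .auxA fun x => .push .main x

theorem exec_pourA (i : List A) (m a b c : List Bool) :
    Exec pourA (st i m a b c) (st i (a.reverse ++ m) [] b c) (2 * a.length + 2) := by
  induction a generalizing m with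
  | nil => exact .each_nil rfl
  | cons x l ih =>
    exact Exec.mono' (c := pourA) (Exec.each_cons (b := x) rfl (update_st_auxA ..)
      (.push_of_eq (update_st_main ..)) (ih (x :: m))) (by simp) (by simp; omega)

/-- Move the content of the second auxiliary stack to the main stack. -/
def pourB : Cmd (Alph A) := .each .auxB fun x => .push .main x

theorem exec_pourB (i : List A) (m a b c : List Bool) :
    Exec pourB (st i m a b c) (st i (b.reverse ++ m) a [] c) (2 * b.length + 2) := by
  induction b generalizing m with
  | nil => exact .each_nil rfl
  | cons x l ih =>
    exact Exec.mono' (c := pourB) (Exec.each_cons (b := x) rfl (update_st_auxB ..)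
      (.push_of_eq (update_st_main ..)) (ih (x :: m))) (by simp) (by simp; omega)

/-- Move the content of the second auxiliary stack to the first one. -/
def pourBA : Cmd (Alph A) := .each .auxB fun x => .push .auxA x

theorem exec_pourBA (i : List A) (m a b c : List Bool) :
    Exec pourBA (st i m a b c) (st i m (b.reverse ++ a) [] c) (2 * b.length + 2) := by
  induction b generalizing a with
  | nil => exact .each_nil rfl
  | cons x l ih =>
    exact Exec.mono' (c := pourBA) (Exec.each_cons (b := x) rfl (update_st_auxB ..)
      (.push_of_eq (update_st_auxA ..)) (ih (x :: a))) (by simp) (by simp; omega)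

/-- Move the content of the first auxiliary stack to both the main stack and the second auxiliary
stack. -/
def pourAMB : Cmd (Alph A) := .each .auxA fun x => .seq (.push .main x) (.push .auxB x)

theorem exec_pourAMB (i : List A) (m a b c : List Bool) :
    Exec pourAMB (st i m a b c) (st i (a.reverse ++ m) [] (a.reverse ++ b) c)
      (3 * a.length + 2) := by
  induction a generalizing m b with
  | nil => exact .each_nil rfl
  | cons x l ih =>
    exact (Exec.each_cons (b := x) rfl (update_st_auxA ..)
      (.seq (.push_of_eq (update_st_main ..)) (.push_of_eq (update_st_auxB ..)))
      (ih (x :: m) (x :: b))).mono' (by simp) (by simp; omega)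

/-- Move as many trees as the counter says from the main stack to the auxiliary stack `k`. -/
def takeLoop (k : Stk) (h : Alph A k = Bool) : Cmd (Alph A) :=
  .each .cnt fun _ => .case .main fun o => o.elim .skip fun x : Bool =>
    .seq (.push k (cast h.symm x)) <|
      cond x (.seq (.push .cnt true) (.push .cnt true)) .skip

/-- The counter holds the number of subtrees still to be read: each symbol uses up one, and a `true`
adds two. The hypothesis is the run that remains after `d`, so that the inductive cases for the two
subtrees chain inside a single loop. One round takes at most 5 steps. -/
theorem exec_takeLoop_auxA (d : BinTree) {i : List A} {r a b c : List Bool} {s' t}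
    (h : Exec (takeLoop .auxA rfl) (st i r (d.word.reverse ++ a) b c) s' t) :
    Exec (takeLoop .auxA rfl) (st i (d.word ++ r) a b (true :: c)) s' (t + 5 * d.size) := by
  induction d generalizing r a c t with
  | nil =>
    exact (Exec.each_cons (b := true) rfl (update_st_cnt ..) (.case (some false) rfl
      (update_st_main ..) (.seq (.push_of_eq (update_st_auxA ..)) (.skip _))) h).mono
      (by simp [BinTree.size]; omega)
  | node d₁ d₂ ih₁ ih₂ =>
    refine (Exec.each_cons (b := true) rfl (update_st_cnt ..) (.case (some true) rfl
      (update_st_main ..) (.seq (.push_of_eq (update_st_auxA ..))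
        (.seq (.push_of_eq (update_st_cnt ..)) (.push_of_eq (update_st_cnt ..)))))
        (t' := t + 5 * d₂.size + 5 * d₁.size) ?_).mono
      (by simp [BinTree.size]; omega)
    have := ih₁ (ih₂ (r := r) (a := d₁.word.reverse ++ (true :: a)) (t := t) (c := c)
      (by simpa [BinTree.word] using h))
    simpa [BinTree.word, takeLoop] using this

theorem exec_takeLoop_auxB (d : BinTree) {i : List A} {r a b c : List Bool} {s' t}
    (h : Exec (takeLoop .auxB rfl) (st i r a (d.word.reverse ++ b) c) s' t) :
    Exec (takeLoop .auxB rfl) (st i (d.word ++ r) a b (true :: c)) s' (t + 5 * d.size) := by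
  induction d generalizing r b c t with
  | nil =>
    exact (Exec.each_cons (b := true) rfl (update_st_cnt ..) (.case (some false) rfl
      (update_st_main ..) (.seq (.push_of_eq (update_st_auxB ..)) (.skip _))) h).mono
      (by simp [BinTree.size]; omega)
  | node d₁ d₂ ih₁ ih₂ =>
    refine (Exec.each_cons (b := true) rfl (update_st_cnt ..) (.case (some true) rfl
      (update_st_main ..) (.seq (.push_of_eq (update_st_auxB ..))
        (.seq (.push_of_eq (update_st_cnt ..)) (.push_of_eq (update_st_cnt ..)))))
        (t' := t + 5 * d₂.size + 5 * d₁.size) ?_).mono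
      (by simp [BinTree.size]; omega)
    have := ih₁ (ih₂ (r := r) (b := d₁.word.reverse ++ (true :: b)) (t := t) (c := c)
      (by simpa [BinTree.word] using h))
    simpa [BinTree.word, takeLoop] using this

/-- Move a tree from the main stack to the first auxiliary stack. -/
def takeA : Cmd (Alph A) := .seq (.push .cnt true) (takeLoop .auxA rfl)

/-- Move a tree from the main stack to the second auxiliary stack. -/
def takeB : Cmd (Alph A) := .seq (.push .cnt true) (takeLoop .auxB rfl)

theorem exec_takeA (d : BinTree) (i : List A) (r a b : List Bool) :
    Exec takeA (st i (d.word ++ r) a b []) (st i r (d.word.reverse ++ a) b []) (5 * d.size + 3) :=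
  (Exec.seq (.push_of_eq (update_st_cnt ..))
    (exec_takeLoop_auxA d (.each_nil rfl))).mono (by omega)

theorem exec_takeB (d : BinTree) (i : List A) (r a b : List Bool) :
    Exec takeB (st i (d.word ++ r) a b []) (st i r a (d.word.reverse ++ b) []) (5 * d.size + 3) :=
  (Exec.seq (.push_of_eq (update_st_cnt ..))
    (exec_takeLoop_auxB d (.each_nil rfl))).mono (by omega)

/-- Stacks with the given input and main stacks, and empty auxiliary stacks. -/
abbrev mst (i : List A) (m : List Bool) : ∀ k, List (Alph A k) := st i m [] [] []

/-- Remove a tree from the main stack. -/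
def drop : Cmd (Alph A) := .seq takeA clearA

theorem exec_drop (d : BinTree) (i : List A) (r : List Bool) :
    Exec drop (mst i (d.word ++ r)) (mst i r) (7 * d.size + 5) :=
  (Exec.seq (exec_takeA d i r [] []) (exec_clearA ..)).mono (by simp; omega)

/-- Duplicate the tree on the main stack. -/
def dup : Cmd (Alph A) := .seq takeA (.seq pourAMB (.seq pourBA pourA))

/-- Every transfer reverses a word, so the second copy passes from `auxB` through `auxA` to reach
the main stack in the right order. -/
theorem exec_dup (d : BinTree) (i : List A) (r : List Bool) :
    Exec dup (mst i (d.word ++ r)) (mst i (d.word ++ (d.word ++ r))) (12 * d.size + 9) :=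
  (Exec.seq (exec_takeA d i r [] []) (.seq (exec_pourAMB ..) (.seq (exec_pourBA ..)
    (exec_pourA ..)))).mono' (by simp) (by simp; omega)

/-- Exchange the two trees on the main stack. -/
def swap : Cmd (Alph A) := .seq takeA (.seq takeB (.seq pourA pourB))

theorem exec_swap (d e : BinTree) (i : List A) (r : List Bool) :
    Exec swap (mst i (d.word ++ (e.word ++ r))) (mst i (e.word ++ (d.word ++ r)))
      (7 * d.size + 7 * e.size + 10) :=
  (Exec.seq (exec_takeA d ..) (.seq (exec_takeB e ..) (.seq (exec_pourA ..)
    (exec_pourB ..)))).mono' (by simp) (by simp; omega)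

end Cmd

end StackLang

/-! ### Functions computable in polynomial time on encodings by trees -/

open StackLang

/-- Types whose elements are encoded by binary trees. -/
class Enc (α : Type) where
  enc : α → BinTree

namespace Enc

/-- The size of the code of an element. -/
def sz {α : Type} [Enc α] (a : α) : ℕ := (enc a).size

/-- The word of the code of an element. -/
def wd {α : Type} [Enc α] (a : α) : List Bool := (enc a).word

instance : Enc BinTree := ⟨id⟩
instance : Enc Unit := ⟨fun _ => .nil⟩
-- These are the codes of `[()]` and `[]`, so that conditionals become case distinctions on lists.
instance : Enc Bool := ⟨fun b => cond b (.node .nil .nil) .nil⟩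
instance {α β : Type} [Enc α] [Enc β] : Enc (α × β) := ⟨fun p => .node (enc p.1) (enc p.2)⟩

/-- The code of a list. -/
def encList {α : Type} [Enc α] : List α → BinTree
  | [] => .nil
  | a :: l => .node (enc a) (encList l)

instance {α : Type} [Enc α] : Enc (List α) := ⟨encList⟩
-- Unary, like the blocks of ticks in the input: the size is linear in the value, and a number is
-- free to serve as a list that drives an iteration.
instance : Enc ℕ := ⟨fun n => enc (List.replicate n ())⟩
instance {α : Type} [Enc α] : Enc (Option α) := ⟨fun o => enc o.toList⟩

section
variable {α β : Type} [Enc α] [Enc β]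

@[simp] theorem length_wd (a : α) : (wd a).length = sz a := BinTree.length_word _

@[simp] theorem sz_prod (p : α × β) : sz p = sz p.1 + sz p.2 + 1 := rfl

@[simp] theorem sz_nil : sz ([] : List α) = 1 := rfl

@[simp] theorem sz_cons (a : α) (l : List α) : sz (a :: l) = sz a + sz l + 1 := rfl

@[simp] theorem sz_none : sz (none : Option α) = 1 := rfl

@[simp] theorem sz_some (a : α) : sz (some a) = sz a + 2 := rfl

@[simp] theorem sz_unit (a : Unit) : sz a = 1 := rfl

theorem sz_bool (b : Bool) : sz b ≤ 3 := by cases b <;> decide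

@[simp] theorem sz_nat (n : ℕ) : sz n = 2 * n + 1 := by
  induction n with
  | zero => rfl
  | succ n ih =>
    have : sz (n + 1) = 1 + sz n + 1 := rfl
    omega

theorem sz_le_of_mem {a : α} {l : List α} (h : a ∈ l) : sz a < sz l := by
  induction l with
  | nil => simp at h
  | cons b l ih =>
    rw [sz_cons]
    rcases List.mem_cons.1 h with rfl | h
    · omega
    · have := ih h; omega

theorem length_lt_sz (l : List α) : l.length < sz l := by
  induction l with
  | nil => simp
  | cons b l ih => simp; omega

@[simp] theorem wd_prod (p : α × β) : wd p = true :: (wd p.1 ++ wd p.2) := rfl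

@[simp] theorem wd_nil : wd ([] : List α) = [false] := rfl

@[simp] theorem wd_cons (a : α) (l : List α) : wd (a :: l) = true :: (wd a ++ wd l) := rfl

@[simp] theorem wd_zero : wd 0 = [false] := rfl

@[simp] theorem wd_succ (n : ℕ) : wd (n + 1) = true :: false :: wd n := rfl

end

/-- Types with an injective encoding. -/
class Inj (α : Type) [Enc α] : Prop where
  inj : Function.Injective (enc : α → BinTree)

instance : Inj Unit := ⟨fun _ _ _ => rfl⟩
instance : Inj Bool := ⟨fun a b h => by cases a <;> cases b <;> simp_all [enc]⟩
instance {α β : Type} [Enc α] [Enc β] [Inj α] [Inj β] : Inj (α × β) :=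
  ⟨fun _ _ h => Prod.ext (Inj.inj (BinTree.node.inj h).1) (Inj.inj (BinTree.node.inj h).2)⟩
instance {α : Type} [Enc α] [Inj α] : Inj (List α) := ⟨fun l m h => by
  induction l generalizing m with
  | nil => cases m with
    | nil => rfl
    | cons => cases h
  | cons a l ih => cases m with
    | nil => cases h
    | cons b m =>
      rw [Inj.inj (BinTree.node.inj h).1, ih _ (BinTree.node.inj h).2]⟩
instance : Inj ℕ := ⟨fun m n h => by
  have : List.replicate m () = List.replicate n () := Inj.inj h
  simpa using congrArg List.length this⟩
instance {α : Type} [Enc α] [Inj α] : Inj (Option α) := ⟨fun o o' h => by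
  have : o.toList = o'.toList := Inj.inj h
  simpa using congrArg List.head? this⟩

end Enc

open Enc

theorem Polynomial.eval_nat_mono (p : Polynomial ℕ) {m n : ℕ} (h : m ≤ n) :
    p.eval m ≤ p.eval n := by
  simp only [Polynomial.eval_eq_sum, Polynomial.sum]
  gcongr

variable {α β γ δ : Type} [Enc α] [Enc β] [Enc γ] [Enc δ]

/-- `PolyTime f`: a program replaces a code of `a` on top of the main stack by the code of `f a`,
in time polynomial in the size of the code of `a`. -/
@[fun_prop]
def PolyTime (f : α → β) : Prop :=
  ∃ (c : Cmd (Alph ShEx.Sym)) (p : Polynomial ℕ), ∀ a r,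
    Exec c (Cmd.mst [] (wd a ++ r)) (Cmd.mst [] (wd (f a) ++ r)) (p.eval (sz a)) ∧
      sz (f a) ≤ p.eval (sz a)

namespace PolyTime

theorem exists_sz_le {f : α → β} (hf : PolyTime f) :
    ∃ p : Polynomial ℕ, ∀ a, sz (f a) ≤ p.eval (sz a) :=
  let ⟨_, p, h⟩ := hf
  ⟨p, fun a => (h a []).2⟩

theorem of_enc_eq {f : α → β} (h : ∀ a, enc (f a) = enc a) : PolyTime f := by
  refine ⟨.skip, .X + 1, fun a r => ⟨?_, ?_⟩⟩
  · rw [show wd (f a) = wd a from congrArg _ (h a)]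
    exact (Exec.skip _).mono (by simp)
  · rw [show sz (f a) = sz a from congrArg _ (h a)]
    simp

@[fun_prop]
theorem id : PolyTime fun a : α => a := of_enc_eq fun _ => rfl

-- The size bound contained in `PolyTime` controls the argument, and thereby the running time, of
-- the second program.
@[fun_prop]
theorem comp {g : β → γ} {f : α → β} (hg : PolyTime g) (hf : PolyTime f) :
    PolyTime fun a => g (f a) := by
  obtain ⟨c, p, hc⟩ := hf
  obtain ⟨d, q, hd⟩ := hg
  refine ⟨.seq c d, p + q.comp p, fun a r => ?_⟩
  simp only [Polynomial.eval_add, Polynomial.eval_comp]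
  have hq := q.eval_nat_mono (hc a r).2
  exact ⟨((hc a r).1.seq (hd (f a) r).1).mono (by omega), (hd (f a) r).2.trans (by omega)⟩

/-- Functions equal on codes. -/
theorem of_enc_eq_comp {g : α → β} {f : α → γ} (hf : PolyTime f) (h : ∀ a, enc (g a) = enc (f a)) :
    PolyTime g := by
  obtain ⟨c, p, hc⟩ := hf
  exact ⟨c, p, fun a r => by
    rw [show wd (g a) = wd (f a) from congrArg _ (h a), show sz (g a) = sz (f a) from
      congrArg _ (h a)]
    exact hc a r⟩

-- The second component is computed first, because the first one has to end up on top, under the tag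
-- `true` of the pair.
@[fun_prop]
theorem pair {f : α → β} {g : α → γ} (hf : PolyTime f) (hg : PolyTime g) :
    PolyTime fun a => (f a, g a) := by
  obtain ⟨c, p, hc⟩ := hf
  obtain ⟨d, q, hd⟩ := hg
  refine ⟨.seq .dup (.seq d (.seq .swap (.seq c (.push .main true)))),
    p + 20 * q + 20 * .X + 30, fun a r => ?_⟩
  simp only [Polynomial.eval_add, Polynomial.eval_mul, Polynomial.eval_X,
    Polynomial.eval_ofNat, sz_prod]
  have h₁ := (hc a (wd (g a) ++ r))
  have h₂ := (hd a (wd a ++ r))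
  refine ⟨?_, by omega⟩
  refine Exec.mono' ((Cmd.exec_dup (enc a) [] r).seq (h₂.1.seq ((Cmd.exec_swap (enc (g a)) (enc a)
    [] r).seq (h₁.1.seq (.push_of_eq (update_st_main ..)))))) (by simp) ?_
  have h₃ : (enc a).size = sz a := rfl
  have h₄ : (enc (g a)).size = sz (g a) := rfl
  omega

@[fun_prop]
theorem fst {f : α → β × γ} (hf : PolyTime f) : PolyTime fun a => (f a).1 := by
  refine comp (g := Prod.fst) ⟨.seq (.pop .main) (.seq .swap .drop),
    20 * .X + 20, fun ⟨a, b⟩ r => ?_⟩ hf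
  simp only [Polynomial.eval_add, Polynomial.eval_mul, Polynomial.eval_X,
    Polynomial.eval_ofNat, sz_prod]
  refine ⟨?_, by omega⟩
  have h₃ : (enc a).size = sz a := rfl
  have h₄ : (enc b).size = sz b := rfl
  refine Exec.mono' (.seq (.pop (s' := Cmd.mst [] (wd a ++ (wd b ++ r))) (by simp))
    ((Cmd.exec_swap (enc a) (enc b) [] r).seq (Cmd.exec_drop (enc b) [] (wd a ++ r)))) rfl ?_
  omega

@[fun_prop]
theorem snd {f : α → β × γ} (hf : PolyTime f) : PolyTime fun a => (f a).2 := by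
  refine comp (g := Prod.snd) ⟨.seq (.pop .main) .drop, 20 * .X + 20, fun ⟨a, b⟩ r => ?_⟩ hf
  simp only [Polynomial.eval_add, Polynomial.eval_mul, Polynomial.eval_X,
    Polynomial.eval_ofNat, sz_prod]
  refine ⟨?_, by omega⟩
  have h₃ : (enc a).size = sz a := rfl
  refine Exec.mono' (.seq (.pop (s' := Cmd.mst [] (wd a ++ (wd b ++ r))) (by simp))
    (Cmd.exec_drop (enc a) [] (wd b ++ r))) rfl ?_
  omega

@[fun_prop]
theorem const (b : β) : PolyTime fun _ : α => b := by
  suffices ∀ d : BinTree, PolyTime fun _ : α => d from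
    of_enc_eq_comp (this (enc b)) fun _ => rfl
  intro d
  induction d with
  | nil =>
    refine ⟨.seq .drop (.push .main false), 20 * .X + 20, fun a r => ⟨?_, ?_⟩⟩
    · have h₃ : (enc a).size = sz a := rfl
      refine Exec.mono' ((Cmd.exec_drop (enc a) [] r).seq
        (.push_of_eq (update_st_main ..))) rfl ?_
      simp only [Polynomial.eval_add, Polynomial.eval_mul, Polynomial.eval_X,
        Polynomial.eval_ofNat]
      omega
    · simp [sz, enc, BinTree.size]
  | node d e hd he => exact of_enc_eq_comp (hd.pair he) fun _ => rfl

/-- Case distinction on a list. -/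
theorem listCases {l : α → List β} {f : α → γ} {g : (β × List β) × α → γ} {h : α → γ}
    (hl : PolyTime l) (hf : PolyTime f) (hg : PolyTime g) (h_nil : ∀ a, l a = [] → h a = f a)
    (h_cons : ∀ a b t, l a = b :: t → h a = g ((b, t), a)) : PolyTime h := by
  obtain ⟨c, p, hc⟩ := hf
  obtain ⟨d, q, hd⟩ := hg
  have hl' := hl.pair id
  obtain ⟨e, u, he⟩ := hl'
  -- `pop` removes the tag of the pair `(l a, a)`, and `case` reads whether the list is empty. If it
  -- is not, the two symbols pushed back complete the rest to the code of `((b, t), a)`.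
  refine ⟨.seq e (.seq (.pop .main) (.case .main fun o => if o = some true then
    .seq (.push .main true) (.seq (.push .main true) d) else c)), u + p + q.comp (u + 1) + 10,
    fun a r => ?_⟩
  have h₁ := he a r
  dsimp only at h₁
  simp only [Polynomial.eval_add, Polynomial.eval_comp, Polynomial.eval_ofNat,
    Polynomial.eval_one]
  cases hla : l a with
  | nil =>
    rw [h_nil a hla]
    rw [hla] at h₁
    refine ⟨Exec.mono' (h₁.1.seq (.seq (.pop (by simp; rfl)) (.case (t := p.eval (sz a))
      (s₁ := Cmd.mst [] (wd a ++ r)) (some false) rfl (update_st_main ..) ?_))) rfl ?_, (hc a r).2.trans ?_⟩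
    · exact (hc a r).1
    all_goals omega
  | cons b t =>
    rw [h_cons a b t hla]
    rw [hla] at h₁
    have h₂ := hd ((b, t), a) r
    have h₃ : sz ((b, t), a) ≤ u.eval (sz a) + 1 := by
      have := h₁.2
      simp at this ⊢
      omega
    have h₄ := q.eval_nat_mono h₃
    refine ⟨Exec.mono' (h₁.1.seq (.seq (.pop (by simp; rfl)) (.case
      (t := 2 + q.eval (sz ((b, t), a))) (some true) rfl
      (update_st_main ..) ?_))) rfl ?_, h₂.2.trans ?_⟩
    · have h₅ : Exec d (Cmd.mst [] (true :: true :: (wd b ++ (wd t ++ (wd a ++ r)))))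
          (Cmd.mst [] (wd (g ((b, t), a)) ++ r)) (q.eval (sz ((b, t), a))) := by
        simpa only [wd_prod, List.cons_append, List.append_assoc] using h₂.1
      exact Exec.mono (.seq (.push_of_eq (update_st_main ..)) (.seq (.push_of_eq
        (update_st_main ..)) h₅)) (by omega)
    · omega
    · omega

/-- The iterates of `g` of small size, the number of iterations being the length of a list on the
main stack. -/
theorem exec_iterate {g : γ → γ} {c : Cmd (Alph ShEx.Sym)} {p : Polynomial ℕ}
    (hc : ∀ a r, Exec c (Cmd.mst [] (wd a ++ r)) (Cmd.mst [] (wd (g a) ++ r)) (p.eval (sz a)) ∧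
      sz (g a) ≤ p.eval (sz a)) (B : ℕ) (r : List Bool) (l : List δ) (s : γ)
    (hl : sz l ≤ B) (hB : ∀ i ≤ l.length, sz (g^[i] s) ≤ B) :
    Exec (.loop .main (fun o => if o = some true then
      .seq .drop (.seq .swap (.seq c .swap)) else .skip) fun o => o == some true)
      (Cmd.mst [] (wd l ++ (wd s ++ r))) (Cmd.mst [] (wd (g^[l.length] s) ++ r))
      (l.length * (p.eval B + 40 * B + 30) + 2) := by
  induction l generalizing s with
  | nil =>
    exact Exec.mono' (Exec.last_of_eq (some false) rfl (update_st_main ..) rfl (.skip _))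
      (by simp) (by simp)
  | cons b l ih =>
    have hs := hB 0 (by simp)
    have hs' := hB 1 (by simp)
    have h₀ : (enc b).size = sz b := rfl
    have h₁ : (enc l).size = sz l := rfl
    have h₂ : (enc s).size = sz s := rfl
    have h₃ : (enc (g s)).size = sz (g s) := rfl
    have hm := p.eval_nat_mono hs
    simp only [Function.iterate_zero, Function.iterate_one, id_eq] at hs hs' hm
    rw [sz_cons] at hl
    have h₄ : Cmd.mst ([] : List ShEx.Sym) (wd b ++ wd l ++ (wd s ++ r)) =
        Cmd.mst [] (wd b ++ (wd l ++ (wd s ++ r))) := by rw [List.append_assoc]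
    refine Exec.mono' (Exec.next_of_eq (some true) rfl ((update_st_main ..).trans h₄) rfl
      (.seq (Cmd.exec_drop (enc b) ..) (.seq (Cmd.exec_swap (enc l) (enc s) [] r)
        (.seq (hc s _).1 (Cmd.exec_swap (enc (g s)) (enc l) [] r))))
      (ih (g s) (by omega) fun i hi => hB (i + 1) (by simpa using hi))) rfl ?_
    rw [List.length_cons, add_mul]
    omega

/-- Iterates of small size, the number of iterations being the length of a list. -/
theorem iterate_length {n : α → List δ} {s : α → γ} {g : γ → γ} (hn : PolyTime n)
    (hs : PolyTime s) (hg : PolyTime g) (q : Polynomial ℕ)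
    (hq : ∀ a, ∀ i ≤ (n a).length, sz (g^[i] (s a)) ≤ q.eval (sz a)) :
    PolyTime fun a => g^[(n a).length] (s a) := by
  obtain ⟨c, p, hc⟩ := hg
  obtain ⟨e, u, he⟩ := hn.pair hs
  refine ⟨.seq e (.seq (.pop .main) (.loop .main (fun o => if o = some true then
      .seq .drop (.seq .swap (.seq c .swap)) else .skip) fun o => o == some true)),
      u + 10 + q + u * (p.comp (q + u) + 40 * (q + u) + 30), fun a r => ?_⟩
  have h₁ := he a r
  have hsz : sz (n a) ≤ u.eval (sz a) := by
    have := h₁.2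
    rw [sz_prod] at this
    dsimp only at this
    omega
  simp only [Polynomial.eval_add, Polynomial.eval_comp, Polynomial.eval_ofNat,
    Polynomial.eval_mul]
  constructor
  · refine Exec.mono' (h₁.1.seq (.seq (.pop (by simp)) (exec_iterate hc
      (q.eval (sz a) + u.eval (sz a)) r (n a) (s a) ?_ ?_))) rfl ?_
    · omega
    · exact fun i hi => (hq a i hi).trans (by omega)
    · have : (n a).length ≤ u.eval (sz a) := by have := length_lt_sz (n a); omega
      have := Nat.mul_le_mul_right (Polynomial.eval (q.eval (sz a) + u.eval (sz a)) p +
        40 * (q.eval (sz a) + u.eval (sz a)) + 30) this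
      omega
  · have := hq a _ le_rfl
    omega

theorem replicate_unit {n : α → ℕ} (hn : PolyTime n) :
    PolyTime fun a => List.replicate (n a) () := of_enc_eq_comp hn fun _ => rfl

/-- Iterates of small size. -/
theorem iterate {n : α → ℕ} {s : α → γ} {g : γ → γ} (hn : PolyTime n) (hs : PolyTime s)
    (hg : PolyTime g) (q : Polynomial ℕ) (hq : ∀ a, ∀ i ≤ n a, sz (g^[i] (s a)) ≤ q.eval (sz a)) :
    PolyTime fun a => g^[n a] (s a) := by
  simpa using iterate_length (replicate_unit hn) hs hg q (by simpa using hq)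

end PolyTime

/-! ### Testing the equality of codes. -/

namespace StackLang.Cmd

/-- Compare the auxiliary stacks, leaving a mark on the counter if they differ. -/
def compare : Cmd (Alph A) :=
  .loop .auxA (fun o : Option Bool => .case .auxB fun o' : Option Bool =>
    if o = o' then .skip else .push .cnt true) Option.isSome

/-- An exhausted stack yields `none`, and `auxB` is popped once more when `auxA` has run out, so
words of different lengths also leave a mark. Of the final contents only the emptiness of the
counter matters; the length bounds pay for the clean-up. -/
theorem exec_compare {A : Type} (i : List A) (m a b c : List Bool) :
    ∃ b' c', Exec compare (st i m a b c) (st i m [] b' c') (3 * a.length + 3) ∧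
      b'.length ≤ b.length ∧ c'.length ≤ c.length + a.length + 1 ∧ (c' = [] ↔ c = [] ∧ a = b) := by
  induction a generalizing b c with
  | nil =>
    cases b with
    | nil =>
      exact ⟨[], c, Exec.mono' (.last_of_eq none rfl (update_st_auxA ..) rfl (.case none rfl
        (update_st_auxB ..) (.skip _))) rfl (by simp), by simp, by simp, by simp⟩
    | cons y b =>
      exact ⟨b, true :: c, Exec.mono' (.last_of_eq none rfl (update_st_auxA ..) rfl
        (.case (some y) rfl (update_st_auxB ..) (.push_of_eq (update_st_cnt ..)))) rfl (by simp),
        by simp, by simp, by simp⟩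
  | cons x a ih =>
    by_cases hxy : b.head? = some x
    · obtain ⟨b', c', h, h₁, h₂, h₃⟩ := ih b.tail c
      obtain ⟨b, rfl⟩ : ∃ b₀, b = x :: b₀ := by cases b <;> simp_all
      refine ⟨b', c', Exec.mono' (.next_of_eq (some x) rfl (update_st_auxA ..) rfl
        (t := 2) (.case (some x) rfl (update_st_auxB ..) ?_) h) rfl ?_, ?_, ?_, ?_⟩
      · rw [if_pos rfl]; exact .skip _
      · simp; omega
      · simp at h₁ ⊢; omega
      · simp; omega
      · simpa using h₃
    · obtain ⟨b', c', h, h₁, h₂, h₃⟩ := ih b.tail (true :: c)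
      refine ⟨b', c', Exec.mono' (.next_of_eq (some x) rfl (update_st_auxA ..) rfl
        (t := 2) (.case b.head? rfl (update_st_auxB ..) ?_) h) rfl ?_, ?_, ?_, ?_⟩
      · rw [if_neg (Ne.symm hxy)]; exact .push_of_eq (update_st_cnt ..)
      · simp; omega
      · simp at h₁ ⊢; omega
      · simp at h₂ ⊢; omega
      · rw [h₃]
        constructor
        · simp
        · rintro ⟨_, rfl⟩
          simp at hxy

/-- Empty the second auxiliary stack. -/
def clearB : Cmd (Alph A) := .each .auxB fun _ => .skip

theorem exec_clearB (i : List A) (m a b c : List Bool) :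
    Exec clearB (st i m a b c) (st i m a [] c) (2 * b.length + 2) := by
  induction b with
  | nil => exact .each_nil rfl
  | cons x l ih =>
    exact (Exec.each_cons (b := x) rfl (update_st_auxB ..) (.skip _) ih).mono' rfl
      (by simp; omega)

/-- Empty the counter. -/
def clearC : Cmd (Alph A) := .each .cnt fun _ => .skip

theorem exec_clearC (i : List A) (m a b c : List Bool) :
    Exec clearC (st i m a b c) (st i m a b []) (2 * c.length + 2) := by
  induction c with
  | nil => exact .each_nil rfl
  | cons x l ih =>
    exact (Exec.each_cons (b := x) rfl (update_st_cnt ..) (.skip _) ih).mono' rfl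
      (by simp; omega)

/-- Replace two trees on the main stack by the truth value of their equality. -/
def eqTest : Cmd (Alph A) :=
  .seq takeA (.seq takeB (.seq compare (.seq clearB (.seq (.case .cnt fun o : Option Bool =>
    if o = none then .seq (.push .main false) (.seq (.push .main false) (.push .main true))
    else .push .main false) clearC))))

theorem exec_eqTest {A : Type} (d e : BinTree) [Decidable (d = e)] (i : List A) (r : List Bool) :
    Exec eqTest (mst i (d.word ++ (e.word ++ r))) (mst i (wd (decide (d = e)) ++ r))
      (20 * d.size + 20 * e.size + 30) := by
  obtain ⟨b', c', h, h₁, h₂, h₃⟩ := exec_compare i r d.word.reverse e.word.reverse []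
  simp only [List.length_reverse, BinTree.length_word, List.length_nil] at h h₁ h₂
  simp only [List.reverse_inj, BinTree.word_injective.eq_iff, true_and] at h₃
  refine Exec.mono' (.seq (exec_takeA d ..) (.seq (exec_takeB e ..) (.seq
    (by simpa using h) (.seq (exec_clearB ..) (.seq
    (s' := st i (wd (decide (d = e)) ++ r) [] [] c'.tail) (t := 4)
    (.case (s₁ := st i r [] [] c'.tail) c'.head? rfl (by simp) ?_) (exec_clearC ..)))))) rfl ?_
  · by_cases hde : d = e
    · have hc := h₃.2 hde
      rw [hc, decide_eq_true hde]
      exact (Exec.push_of_eq (update_st_main ..)).seq ((Exec.push_of_eq (update_st_main ..)).seq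
        (.push_of_eq (update_st_main ..)))
    · have hc := mt h₃.1 hde
      rw [if_neg (by simpa using hc), decide_eq_false hde]
      exact (Exec.push_of_eq (update_st_main ..)).mono (by omega)
  · simp; omega

end StackLang.Cmd

namespace PolyTime

theorem decide_eq {f g : α → β} [Inj β] [DecidableEq β] (hf : PolyTime f) (hg : PolyTime g) :
    PolyTime fun a => decide (f a = g a) := by
  refine comp (g := fun p : β × β => decide (p.1 = p.2)) ⟨.seq (.pop .main) .eqTest,
    20 * .X + 50, fun ⟨a, b⟩ r => ?_⟩ (hf.pair hg)
  simp only [Polynomial.eval_add, Polynomial.eval_mul, Polynomial.eval_X,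
    Polynomial.eval_ofNat, sz_prod]
  refine ⟨?_, (sz_bool _).trans (by omega)⟩
  have h₃ : (enc a).size = sz a := rfl
  have h₄ : (enc b).size = sz b := rfl
  classical
  have : decide (a = b) = decide (enc a = enc b) := by
    simp [(Inj.inj (α := β)).eq_iff]
  rw [this]
  refine Exec.mono' (.seq (.pop (s' := Cmd.mst [] (wd a ++ (wd b ++ r))) (by simp))
    (Cmd.exec_eqTest (enc a) (enc b) [] r)) rfl ?_
  omega

end PolyTime

/-! ### From polynomial-time functions to Turing machines -/

open StackLang Enc

namespace ShEx

/-- A number for each symbol. -/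
def Sym.code : Sym → ℕ
  | tick => 0
  | edge => 1
  | sep => 2
  | bit false => 3
  | bit true => 4
  | occ .one => 5
  | occ .opt => 6
  | occ .plus => 7
  | occ .star => 8

theorem Sym.code_injective : Function.Injective Sym.code := by
  rintro (_ | _ | _ | (_ | _) | (_ | _ | _ | _)) (_ | _ | _ | (_ | _) | (_ | _ | _ | _)) <;>
    simp [code]

instance : Finite Sym := Finite.of_injective (fun s => (⟨s.code, by
    rcases s with (_ | _ | _ | (_ | _) | (_ | _ | _ | _)) <;> simp [Sym.code]⟩ : Fin 9))
  fun _ _ h => Sym.code_injective (Fin.mk.inj h)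

instance : DecidableEq Sym := fun _ _ => decidable_of_iff _ Sym.code_injective.eq_iff

instance : Enc Sym := ⟨fun s => enc s.code⟩

instance : Inj Sym := ⟨fun _ _ h => Sym.code_injective (Inj.inj h)⟩

theorem Sym.sz_le (s : Sym) : sz s ≤ 17 := by
  have : sz s = sz s.code := rfl
  rw [this, sz_nat]
  rcases s with (_ | _ | _ | (_ | _) | (_ | _ | _ | _)) <;> simp [Sym.code]

end ShEx

namespace StackLang.Cmd

open ShEx

/-- Push a word on the main stack. -/
def pushWord {A : Type} : List Bool → Cmd (Alph A)
  | [] => .skip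
  | b :: w => .seq (pushWord w) (.push .main b)

theorem exec_pushWord {A : Type} (i : List A) (m w : List Bool) :
    Exec (pushWord w) (mst i m) (mst i (w ++ m)) (w.length + 1) := by
  induction w with
  | nil => exact .skip _
  | cons b w ih => exact ih.seq (.push_of_eq (update_st_main ..))

/-- Move the input to the main stack as the code of the reversed list. -/
def load : Cmd (Alph Sym) :=
  .seq (.push .main false) (.each .inp fun s : Sym => .seq (pushWord (wd s)) (.push .main true))

theorem exec_load (l : List Sym) :
    Exec load (mst l []) (mst [] (wd l.reverse)) (20 * l.length + 3) := by
  have key : ∀ l l' : List Sym,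
      Exec (.each .inp fun s : Sym => .seq (pushWord (wd s)) (.push .main true)) (mst l (wd l'))
        (mst [] (wd (l.reverse ++ l'))) (20 * l.length + 2) := by
    intro l
    induction l with
    | nil => exact fun l' => .each_nil rfl
    | cons s l ih =>
      intro l'
      refine Exec.mono' (.each_cons (b := s) rfl (update_st_inp ..) (.seq (exec_pushWord ..)
        (.push_of_eq (update_st_main ..))) (ih (s :: l'))) (by simp) ?_
      have := s.sz_le
      simp
      omega
  exact (Exec.seq (.push_of_eq (update_st_main ..)) (key l [])).mono' (by simp) (by omega)

/-- Replace the code of a truth value by the truth value. -/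
def unload {A : Type} : Cmd (Alph A) :=
  .case .main fun o : Option Bool => if o = some true then
    .seq (.pop .main) (.seq (.pop .main) (.push .main true)) else .push .main false

theorem exec_unload {A : Type} (b : Bool) :
    Exec unload (mst ([] : List A) (wd b)) (mst [] [b]) 6 := by
  cases b with
  | false => exact Exec.mono (.case (some false) rfl (update_st_main ..)
      (.push_of_eq (update_st_main ..))) (by omega)
  | true => exact .case (some true) rfl (update_st_main ..) (.seq (.pop (update_st_main ..))
      (.seq (.pop (update_st_main ..)) (.push_of_eq (update_st_main ..))))

end StackLang.Cmd

namespace StackLang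

open Turing ShEx StateTransition

/-- The Turing machine of a program. It halts at the label `none`. -/
noncomputable def machine (c : Cmd (Alph Sym)) : FinTM2 where
  K := Stk
  kFin := Fintype.ofFinite _
  k₀ := .inp
  k₁ := .main
  Γ := Alph Sym
  Λ := Option c.Lbl
  main := some c.entry
  ΛFin :=
    have : ∀ k, Finite (Alph Sym k) := fun k => by cases k <;> dsimp only [Alph] <;> infer_instance
    Fintype.ofFinite _
  σ := ∀ k, Option (Alph Sym k)
  initialState := fun _ => none
  σFin :=
    have : ∀ k, Finite (Alph Sym k) := fun k => by cases k <;> dsimp only [Alph] <;> infer_instance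
    Fintype.ofFinite _
  Γk₀Fin := Fintype.ofFinite Sym
  -- An accepted final configuration has the local variable in its initial state, hence the reset
  -- before halting.
  m l := l.elim (.load (fun _ _ => none) .halt) (c.code some none)

theorem initList_machine (c : Cmd (Alph Sym)) (x : List Sym) :
    initList (machine c) x = ⟨some (some c.entry), fun _ => none, Cmd.mst x []⟩ := by
  simp only [initList, machine]
  congr 1
  funext k
  cases k <;> rfl

theorem haltList_machine (c : Cmd (Alph Sym)) (w : List Bool) :
    haltList (machine c) w = ⟨none, fun _ => none, Cmd.mst [] w⟩ := by
  simp only [haltList, machine]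
  congr 1
  funext k
  cases k <;> rfl

/-- A machine outputs what its program computes. -/
theorem outputs_of_exec {c : Cmd (Alph Sym)} {x : List Sym} {w : List Bool} {t : ℕ}
    (h : Exec c (Cmd.mst x []) (Cmd.mst [] w) t) :
    Nonempty (TM2OutputsInTime (machine c) x (some w) (t + 1)) := by
  obtain ⟨v, ⟨h⟩⟩ := Cmd.evals_of_exec (M := (machine c).m) h (emb := some) (exit := none)
    (fun _ => rfl) fun _ => none
  refine ⟨?_⟩
  rw [add_comm]
  change EvalsToInTime (machine c).step (initList (machine c) x)
    (some (haltList (machine c) w)) (1 + t)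
  rw [initList_machine, haltList_machine]
  exact h.trans _ _ _ _ _ _ ⟨⟨1, rfl⟩, le_rfl⟩

end StackLang

/-- A language is in P if membership of the reversed word is a polynomial-time function. -/
theorem PolyTime.inP {L : Language ShEx.Sym} {f : List ShEx.Sym → Bool} (hf : PolyTime f)
    (h : ∀ x, f x.reverse = true ↔ x ∈ L) : ShEx.InP L := by
  obtain ⟨c, p, hc⟩ := hf
  let d : Cmd (Alph ShEx.Sym) := .seq .load (.seq c .unload)
  have key : ∀ x : List ShEx.Sym, Exec d (Cmd.mst x []) (Cmd.mst [] [f x.reverse])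
      ((20 * .X + p.comp (20 * .X + 20) + 20 : Polynomial ℕ).eval x.length) := by
    intro x
    refine Exec.mono ((Cmd.exec_load x).seq (Exec.seq (t := p.eval (sz x.reverse))
      (s' := Cmd.mst [] (wd (f x.reverse))) (by simpa using (hc x.reverse []).1)
      (Cmd.exec_unload _))) ?_
    have h₁ : sz x.reverse ≤ 20 * x.length + 20 := by
      rw [← x.length_reverse]
      generalize x.reverse = l
      induction l with
      | nil => simp
      | cons s l ih => have := s.sz_le; simp; omega
    have := p.eval_nat_mono h₁
    simp only [Polynomial.eval_add, Polynomial.eval_mul, Polynomial.eval_X,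
      Polynomial.eval_ofNat, Polynomial.eval_comp]
    omega
  refine ⟨⟨⟨machine d, Equiv.refl _, Equiv.refl _⟩, 20 * .X + p.comp (20 * .X + 20) + 20 + 1,
    fun x => Classical.choice ?_⟩⟩
  have h₁ := outputs_of_exec (key x)
  have h₂ : f x.reverse = @Decidable.decide (x ∈ L) (Classical.propDecidable _) := by
    rw [Bool.eq_iff_iff, h, @decide_eq_true_iff _ (Classical.propDecidable _)]
  rw [h₂] at h₁
  -- The definition of `InP` presents the input as `x.map id`, up to unfolding, and not literally as
  -- `x`.
  have h₃ : ∀ (y : List ShEx.Sym) (b : Bool) (t : ℕ), y = x →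
      Nonempty (Turing.TM2OutputsInTime (machine d) x (some [b]) t) →
      Nonempty (Turing.TM2OutputsInTime (machine d) y (some [b]) t) := by
    rintro _ _ _ rfl h
    exact h
  rw [← Polynomial.eval_one (x := x.length), ← Polynomial.eval_add] at h₁
  exact h₃ _ _ _ x.map_id h₁

/-! ### Closure properties of polynomial-time functions -/

open Enc

namespace PolyTime

variable {α β γ δ : Type} [Enc α] [Enc β] [Enc γ] [Enc δ]

@[fun_prop]
theorem cons {f : α → β} {l : α → List β} (hf : PolyTime f) (hl : PolyTime l) :
    PolyTime fun a => f a :: l a := of_enc_eq_comp (hf.pair hl) fun _ => rfl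

@[fun_prop]
theorem some {f : α → β} (hf : PolyTime f) : PolyTime fun a => Option.some (f a) :=
  of_enc_eq_comp (hf.cons (const [])) fun _ => rfl

@[fun_prop]
theorem toList {f : α → Option β} (hf : PolyTime f) : PolyTime fun a => (f a).toList :=
  of_enc_eq_comp hf fun _ => rfl

@[fun_prop]
theorem succ {n : α → ℕ} (hn : PolyTime n) : PolyTime fun a => n a + 1 :=
  of_enc_eq_comp ((const ()).pair hn) fun _ => rfl

@[fun_prop]
theorem tail {l : α → List β} (hl : PolyTime l) : PolyTime fun a => (l a).tail :=
  listCases hl (const []) id.fst.snd (fun a h => by simp [h]) (fun a b t h => by simp [h])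

@[fun_prop]
theorem head? {l : α → List β} (hl : PolyTime l) : PolyTime fun a => (l a).head? :=
  listCases hl (const none) id.fst.fst.some (fun a h => by simp [h]) (fun a b t h => by simp [h])

@[fun_prop]
theorem optionElim {o : α → Option β} {f : α → γ} {g : α → β → γ} (ho : PolyTime o)
    (hf : PolyTime f) (hg : PolyTime fun p : α × β => g p.1 p.2) :
    PolyTime fun a => (o a).elim (f a) (g a) := by
  refine listCases ho.toList hf (comp hg (id.snd.pair id.fst.fst)) (fun a h => ?_)
    (fun a b t h => ?_)
  · rw [Option.toList_eq_nil_iff.1 h]; rfl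
  · cases h' : o a <;> simp_all

@[fun_prop]
theorem getD {o : α → Option β} {f : α → β} (ho : PolyTime o) (hf : PolyTime f) :
    PolyTime fun a => (o a).getD (f a) := by
  refine of_enc_eq_comp (ho.optionElim hf (g := fun _ b => b) id.snd) fun a => ?_
  cases o a <;> rfl

/-- Conditionals. -/
@[fun_prop]
theorem ite {p : α → Prop} [DecidablePred p] {f g : α → γ} (hp : PolyTime fun a => decide (p a))
    (hf : PolyTime f) (hg : PolyTime g) : PolyTime fun a => if p a then f a else g a := by
  have h : PolyTime fun a => if p a then [()] else [] :=
    of_enc_eq_comp hp fun a => by by_cases h : p a <;> simp only [h] <;> rfl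
  refine listCases h hg (comp hf id.snd) (fun a h => ?_) (fun a b t h => ?_)
  · by_cases hp : p a <;> simp_all
  · by_cases hp : p a <;> simp_all

@[fun_prop]
theorem and {b c : α → Bool} (hb : PolyTime b) (hc : PolyTime c) :
    PolyTime fun a => b a && c a := by
  refine of_enc_eq_comp (ite (p := fun a => b a = true) (f := c) (g := fun _ => false)
    (by simpa using hb) hc (const _)) fun a => ?_
  cases b a <;> rfl

@[fun_prop]
theorem or {b c : α → Bool} (hb : PolyTime b) (hc : PolyTime c) :
    PolyTime fun a => b a || c a := by
  refine of_enc_eq_comp (ite (p := fun a => b a = true) (f := fun _ => true) (g := c)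
    (by simpa using hb) (const _) hc) fun a => ?_
  cases b a <;> rfl

@[fun_prop]
theorem not {b : α → Bool} (hb : PolyTime b) : PolyTime fun a => !b a := by
  refine of_enc_eq_comp (ite (p := fun a => b a = true) (f := fun _ => false) (g := fun _ => true)
    (by simpa using hb) (const _) (const _)) fun a => ?_
  cases b a <;> rfl

attribute [fun_prop] decide_eq

@[fun_prop]
theorem decide_eq_true {b : α → Bool} (hb : PolyTime b) : PolyTime fun a => decide (b a = true) := by
  simpa using hb

/-- Functions on a finite type. -/
theorem of_finite [Finite β] [Inj β] {f : α → β} (hf : PolyTime f) (g : β → γ) :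
    PolyTime fun a => g (f a) := by
  classical
  have := Fintype.ofFinite β
  rcases isEmpty_or_nonempty γ with h | ⟨⟨c⟩⟩
  · exact ⟨.skip, 0, fun a => h.elim (g (f a))⟩
  -- A look-up table, built entry by entry; `c` is the value for arguments not yet in the table.
  suffices ∀ l : List β, PolyTime fun b : β => if b ∈ l then g b else c by
    refine of_enc_eq_comp (comp (this Finset.univ.toList) hf) fun a => by simp
  intro l
  induction l with
  | nil => exact of_enc_eq_comp (const c) fun _ => by simp
  | cons x l ih =>
    refine of_enc_eq_comp (ite (p := fun b : β => b = x) (decide_eq id (const x))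
      (const (g x)) ih) fun b => ?_
    by_cases h : b = x <;> simp [h]

/-- Left folds with small intermediate values. -/
theorem foldl_of_le {l : α → List β} {s : α → γ} {f : α → γ → β → γ} (hl : PolyTime l)
    (hs : PolyTime s) (hf : PolyTime fun p : α × γ × β => f p.1 p.2.1 p.2.2) (q : Polynomial ℕ)
    (hq : ∀ a i, sz (((l a).take i).foldl (f a) (s a)) ≤ q.eval (sz a)) :
    PolyTime fun a => (l a).foldl (f a) (s a) := by
  -- Only a function of the state alone can be iterated, so the state also carries the parameter
  -- `a`; it stays fixed once the list is used up.
  let step : List β × γ × α → List β × γ × α := fun p =>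
    p.1.head?.elim p fun b => (p.1.tail, f p.2.2 p.2.1 b, p.2.2)
  have h_step : PolyTime step := by
    refine optionElim (by fun_prop) id ?_
    have := comp hf (f := fun p : (List β × γ × α) × β => (p.1.2.2, p.1.2.1, p.2)) (by fun_prop)
    exact id.fst.fst.tail.pair (this.pair id.fst.snd.snd)
  have key : ∀ a i, step^[i] (l a, s a, a) = ((l a).drop i, ((l a).take i).foldl (f a) (s a), a) := by
    intro a i
    induction i with
    | zero => simp
    | succ i ih =>
      rw [Function.iterate_succ_apply', ih, List.take_add_one, List.foldl_append]
      simp only [step, List.head?_drop, List.tail_drop]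
      cases h : (l a)[i]? with
      | none =>
        have := List.getElem?_eq_none_iff.1 h
        simp [List.drop_eq_nil_of_le this, List.drop_eq_nil_of_le (this.trans (Nat.le_succ i))]
      | some b => simp
  have h_drop : ∀ (m : List β) i, sz (m.drop i) ≤ sz m := by
    intro m
    induction m with
    | nil => simp
    | cons b m ih =>
      intro i
      cases i with
      | zero => simp
      | succ i => simpa using (ih i).trans (by omega)
  obtain ⟨u, hu⟩ := hl.exists_sz_le
  have := iterate_length hl (hl.pair (hs.pair id)) h_step (u + q + .X + 2) fun a i _ => by
    rw [key]
    have h₁ := h_drop (l a) i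
    have h₂ := hu a
    have h₃ := hq a i
    simp only [sz_prod, Polynomial.eval_add, Polynomial.eval_X, Polynomial.eval_ofNat]
    omega
  refine of_enc_eq_comp this.snd.fst fun a => ?_
  rw [key, List.take_length]

/-- Left folds in which every step adds little to the size. -/
theorem foldl {l : α → List β} {s : α → γ} {f : α → γ → β → γ} (hl : PolyTime l)
    (hs : PolyTime s) (hf : PolyTime fun p : α × γ × β => f p.1 p.2.1 p.2.2) (q : Polynomial ℕ)
    (hq : ∀ a s, ∀ b ∈ l a, sz (f a s b) ≤ sz s + q.eval (sz a)) :
    PolyTime fun a => (l a).foldl (f a) (s a) := by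
  obtain ⟨u, hu⟩ := hl.exists_sz_le
  obtain ⟨v, hv⟩ := hs.exists_sz_le
  refine foldl_of_le hl hs hf (v + u * q) fun a i => ?_
  have key : ∀ (m : List β) s, (∀ b ∈ m, b ∈ l a) →
      sz (m.foldl (f a) s) ≤ sz s + m.length * q.eval (sz a) := by
    intro m
    induction m with
    | nil => simp
    | cons b m ih =>
      intro s hm
      have h₁ := ih (f a s b) fun b hb => hm b (by simp [hb])
      have h₂ := hq a s b (hm b (by simp))
      rw [List.foldl_cons, List.length_cons, add_mul]
      omega
  have h₁ := key ((l a).take i) (s a) fun b => List.mem_of_mem_take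
  have h₂ := hv a
  have h₃ : ((l a).take i).length ≤ u.eval (sz a) := by
    have := length_lt_sz (l a)
    have := hu a
    have := List.length_take_le i (l a)
    have := List.length_take_le' i (l a)
    omega
  have := Nat.mul_le_mul_right (q.eval (sz a)) h₃
  simp only [Polynomial.eval_add, Polynomial.eval_mul]
  omega

@[fun_prop]
theorem reverse {l : α → List β} (hl : PolyTime l) : PolyTime fun a => (l a).reverse := by
  obtain ⟨u, hu⟩ := hl.exists_sz_le
  refine of_enc_eq_comp (foldl hl (const []) (f := fun _ acc b => b :: acc) (by fun_prop) (u + 1)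
    fun a s b hb => ?_) fun a => by rw [List.foldl_flip_cons_eq_append', List.append_nil]
  have := sz_le_of_mem hb
  have := hu a
  simp
  omega

theorem foldr {l : α → List β} {s : α → γ} {f : α → β → γ → γ} (hl : PolyTime l)
    (hs : PolyTime s) (hf : PolyTime fun p : α × γ × β => f p.1 p.2.2 p.2.1) (q : Polynomial ℕ)
    (hq : ∀ a s, ∀ b ∈ l a, sz (f a b s) ≤ sz s + q.eval (sz a)) :
    PolyTime fun a => (l a).foldr (f a) (s a) := by
  refine of_enc_eq_comp (foldl hl.reverse hs (f := fun a s b => f a b s) hf q fun a s b hb =>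
    hq a s b (by simpa using hb)) fun a => by rw [List.foldr_eq_foldl_reverse]

theorem exists_sz_le_of_mem {l : α → List β} {f : α → β → γ} (hl : PolyTime l)
    (hf : PolyTime fun p : α × β => f p.1 p.2) :
    ∃ q : Polynomial ℕ, ∀ a, ∀ b ∈ l a, sz (f a b) ≤ q.eval (sz a) := by
  obtain ⟨u, hu⟩ := hl.exists_sz_le
  obtain ⟨v, hv⟩ := hf.exists_sz_le
  refine ⟨v.comp (.X + u + 1), fun a b hb => ?_⟩
  have := sz_le_of_mem hb
  have := hu a
  simp only [Polynomial.eval_comp, Polynomial.eval_add, Polynomial.eval_X, Polynomial.eval_one]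
  exact (hv (a, b)).trans (v.eval_nat_mono (by simp; omega))

@[fun_prop]
theorem map {l : α → List β} {f : α → β → γ} (hl : PolyTime l)
    (hf : PolyTime fun p : α × β => f p.1 p.2) : PolyTime fun a => (l a).map (f a) := by
  obtain ⟨q, hq⟩ := exists_sz_le_of_mem hl hf
  refine of_enc_eq_comp (foldr hl (const []) (f := fun a b acc => f a b :: acc) ?_ (q + 1)
    fun a s b hb => ?_) fun a => by rw [List.map_eq_foldr]
  · exact (comp hf (id.fst.pair id.snd.snd)).cons id.snd.fst
  · have := hq a b hb
    simp
    omega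

@[fun_prop]
theorem filter {l : α → List β} {f : α → β → Bool} (hl : PolyTime l)
    (hf : PolyTime fun p : α × β => f p.1 p.2) : PolyTime fun a => (l a).filter (f a) := by
  obtain ⟨u, hu⟩ := hl.exists_sz_le
  refine of_enc_eq_comp (foldr hl (const []) (f := fun a b acc => if f a b = true then b :: acc
    else acc) ?_ (u + 1) fun a s b hb => ?_) (g := fun a => (l a).filter (f a)) fun a => ?_
  · have := comp hf (f := fun p : α × List β × β => (p.1, p.2.2)) (by fun_prop)
    exact ite this.decide_eq_true (by fun_prop) (by fun_prop)
  · have := sz_le_of_mem hb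
    have := hu a
    simp
    split_ifs
    · simp; omega
    · omega
  · congr 1
    induction l a with
    | nil => rfl
    | cons b m ih => by_cases h : f a b = true <;> simp [h, ih]

@[fun_prop]
theorem any {l : α → List β} {f : α → β → Bool} (hl : PolyTime l)
    (hf : PolyTime fun p : α × β => f p.1 p.2) : PolyTime fun a => (l a).any (f a) := by
  refine of_enc_eq_comp (foldr hl (const false) (f := fun a b r => f a b || r) ?_ 3
    fun a s b hb => ?_) fun a => by congr 1; induction l a <;> simp [*]
  · have := comp hf (f := fun p : α × Bool × β => (p.1, p.2.2)) (by fun_prop)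
    exact or this (by fun_prop)
  · have := sz_bool (f a b || s)
    simp
    omega

@[fun_prop]
theorem all {l : α → List β} {f : α → β → Bool} (hl : PolyTime l)
    (hf : PolyTime fun p : α × β => f p.1 p.2) : PolyTime fun a => (l a).all (f a) := by
  refine of_enc_eq_comp (not (any hl (f := fun a b => !f a b) hf.not)) fun a => by
    rw [List.all_eq_not_any_not]

@[fun_prop]
theorem find? {l : α → List β} {f : α → β → Bool} (hl : PolyTime l)
    (hf : PolyTime fun p : α × β => f p.1 p.2) : PolyTime fun a => (l a).find? (f a) :=
  of_enc_eq_comp (head? (filter hl hf)) fun a => by rw [List.head?_filter]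

@[fun_prop]
theorem append {l m : α → List β} (hl : PolyTime l) (hm : PolyTime m) :
    PolyTime fun a => l a ++ m a := by
  obtain ⟨u, hu⟩ := hl.exists_sz_le
  refine of_enc_eq_comp (foldr hl hm (f := fun _ b acc => b :: acc) (by fun_prop) (u + 1)
    fun a s b hb => ?_) fun a => by rw [List.foldr_cons_eq_append']
  have := sz_le_of_mem hb
  have := hu a
  simp
  omega

theorem _root_.Enc.sz_append (l m : List α) : sz (l ++ m) + 1 = sz l + sz m := by
  induction l with
  | nil => simp; omega
  | cons a l ih => simp; omega

@[fun_prop]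
theorem flatMap {l : α → List β} {f : α → β → List γ} (hl : PolyTime l)
    (hf : PolyTime fun p : α × β => f p.1 p.2) : PolyTime fun a => (l a).flatMap (f a) := by
  obtain ⟨q, hq⟩ := exists_sz_le_of_mem hl hf
  refine of_enc_eq_comp (foldr hl (const []) (f := fun a b acc => f a b ++ acc) ?_ q
    fun a s b hb => ?_) (g := fun a => (l a).flatMap (f a)) fun a => ?_
  · have := comp hf (f := fun p : α × List γ × β => (p.1, p.2.2)) (by fun_prop)
    exact append this (by fun_prop)
  · have := hq a b hb
    have := sz_append (f a b) s
    omega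
  · congr 1
    induction l a with
    | nil => rfl
    | cons b m ih => simp [ih]

@[fun_prop]
theorem length {l : α → List β} (hl : PolyTime l) : PolyTime fun a => (l a).length := by
  refine of_enc_eq_comp (map hl (f := fun _ _ => ()) (by fun_prop)) fun a => ?_
  rw [List.map_const']
  rfl

@[fun_prop]
theorem replicate {n : α → ℕ} {f : α → β} (hn : PolyTime n) (hf : PolyTime f) :
    PolyTime fun a => List.replicate (n a) (f a) := by
  refine of_enc_eq_comp (map (replicate_unit hn) (f := fun a _ => f a) (comp hf id.fst)) fun a => ?_
  simp

theorem _root_.Enc.sz_tail_le (l : List α) : sz l.tail ≤ sz l := by cases l <;> simp; omega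

@[fun_prop]
theorem drop {n : α → ℕ} {l : α → List β} (hn : PolyTime n) (hl : PolyTime l) :
    PolyTime fun a => (l a).drop (n a) := by
  obtain ⟨u, hu⟩ := hl.exists_sz_le
  refine of_enc_eq_comp (iterate hn hl (g := List.tail) (by fun_prop) u fun a i hi => ?_) fun a => ?_
  · clear hi
    refine le_trans ?_ (hu a)
    induction i with
    | zero => simp
    | succ i ih =>
      rw [Function.iterate_succ_apply']
      exact (sz_tail_le _).trans ih
  · congr 1
    generalize n a = i
    induction i with
    | zero => rfl
    | succ i ih => rw [Function.iterate_succ_apply', ← ih, List.tail_drop]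

@[fun_prop]
theorem listGetD {n : α → ℕ} {l : α → List β} {f : α → β} (hl : PolyTime l) (hn : PolyTime n)
    (hf : PolyTime f) : PolyTime fun a => (l a).getD (n a) (f a) :=
  of_enc_eq_comp (getD (head? (drop hn hl)) hf) fun a => by
    rw [List.head?_drop, List.getD_eq_getElem?_getD]

-- In unary, `m < n` means that something is left of `n` units after dropping `m` of them.
@[fun_prop]
theorem decide_lt {m n : α → ℕ} (hm : PolyTime m) (hn : PolyTime n) :
    PolyTime fun a => decide (m a < n a) :=
  of_enc_eq_comp (not (decide_eq (drop hm (replicate_unit hn)) (const []))) fun a => by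
    congr 1
    rw [Bool.eq_iff_iff]
    simp
    omega

-- The length of the list built so far is the next number, so iterating `l.length :: l` produces the
-- range in reverse.
@[fun_prop]
theorem range {n : α → ℕ} (hn : PolyTime n) : PolyTime fun a => List.range (n a) := by
  obtain ⟨u, hu⟩ := hn.exists_sz_le
  have key : ∀ i, (fun l : List ℕ => l.length :: l)^[i] [] = (List.range i).reverse := by
    intro i
    induction i with
    | zero => rfl
    | succ i ih => rw [Function.iterate_succ_apply', ih, List.range_succ]; simp
  refine of_enc_eq_comp (reverse (iterate hn (const []) (g := fun l : List ℕ => l.length :: l)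
    (by fun_prop) (u * (2 * u + 2) + 1) fun a i hi => ?_)) fun a => by rw [key]; simp
  have h₁ := hu a
  rw [sz_nat] at h₁
  have h₂ : sz ((fun l : List ℕ => l.length :: l)^[i] []) ≤ i * (2 * u.eval (sz a) + 2) + 1 := by
    clear h₁
    induction i with
    | zero => simp
    | succ i ih =>
      have h₃ := ih (by omega)
      have h₄ := hu a
      rw [sz_nat] at h₄
      rw [Function.iterate_succ_apply', sz_cons, sz_nat, key, List.length_reverse,
        List.length_range, add_mul, ← key]
      omega
  have := Nat.mul_le_mul_right (2 * u.eval (sz a) + 2) (show i ≤ u.eval (sz a) by omega)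
  simp only [Polynomial.eval_add, Polynomial.eval_mul, Polynomial.eval_ofNat, Polynomial.eval_one]
  omega

end PolyTime

/-! ### Perfect matchings by an auction -/

open Enc

namespace Auction

variable {β : Type} [DecidableEq β]

/-- The latest bidder for the item `u` in a history `h` of pairs of a bidder and an item. -/
def owner (h : List (β × β)) (u : β) : Option β :=
  (h.find? fun p => decide (p.2 = u)).elim none fun p => some p.1

/-- The number of bids for `u`. -/
def price (h : List (β × β)) (u : β) : ℕ := (h.filter fun p => decide (p.2 = u)).length

/-- `v` owns an item. -/
def assigned (V : List β) (h : List (β × β)) (v : β) : Bool :=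
  V.any fun u => decide (owner h u = some v)

/-- An item of minimal price. -/
def cheapest (h : List (β × β)) (l : List β) : Option β :=
  l.foldr (fun u o => o.elim (some u) fun w => if price h u < price h w then some u else some w)
    none

/-- A bidder without an item bids for the cheapest item admissible for it. -/
def bid (V : List β) (adm : β → β → Bool) (h : List (β × β)) : List (β × β) :=
  (V.find? fun v => !assigned V h v).elim h fun v =>
    (cheapest h (V.filter fun u => adm v u)).elim h fun u => (v, u) :: h

/-- The auction ends with all bidders owning an item. -/
def perfect (V : List β) (adm : β → β → Bool) : Bool :=
  -- With `n = V.length` these are `n * (n + 1)` rounds, for `n > 0` more than the `n * n` bids that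
  -- are possible if a perfect matching exists.
  V.all fun v => assigned V ((bid V adm)^[(V.flatMap fun v => v :: V).length] []) v

@[simp] theorem owner_nil (u : β) : owner [] u = none := rfl

theorem owner_cons (v u w : β) (h : List (β × β)) :
    owner ((v, u) :: h) w = if u = w then some v else owner h w := by
  by_cases huw : u = w <;> simp [owner, huw]

theorem price_cons (v u w : β) (h : List (β × β)) :
    price ((v, u) :: h) w = price h w + if u = w then 1 else 0 := by
  by_cases huw : u = w <;> simp [price, huw]

theorem exists_owner_of_price_pos {h : List (β × β)} {u : β} (hp : 0 < price h u) :
    ∃ v, owner h u = some v := by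
  induction h with
  | nil => simp [price] at hp
  | cons p h ih =>
    obtain ⟨v, u'⟩ := p
    rw [price_cons] at hp
    rw [owner_cons]
    split_ifs with huu
    · exact ⟨v, rfl⟩
    · exact ih (by simpa [huu] using hp)

theorem mem_of_owner {h : List (β × β)} {u v : β} (ho : owner h u = some v) : (v, u) ∈ h := by
  induction h with
  | nil => simp at ho
  | cons p h ih =>
    obtain ⟨v', u'⟩ := p
    rw [owner_cons] at ho
    split_ifs at ho with huu
    · simp_all
    · exact List.mem_cons_of_mem _ (ih ho)

theorem cheapest_spec (h : List (β × β)) (l : List β) :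
    (l = [] ∧ cheapest h l = none) ∨
      ∃ u ∈ l, cheapest h l = some u ∧ ∀ w ∈ l, price h u ≤ price h w := by
  induction l with
  | nil => exact .inl ⟨rfl, rfl⟩
  | cons u l ih =>
    right
    have hc : cheapest h (u :: l) = (cheapest h l).elim (some u) fun w =>
      if price h u < price h w then some u else some w := rfl
    rcases ih with ⟨rfl, hn⟩ | ⟨w, hw, hs, hmin⟩
    · exact ⟨u, by simp, by rw [hc, hn]; rfl, by simp⟩
    · rw [hc, hs, Option.elim_some]
      by_cases hlt : price h u < price h w
      · refine ⟨u, by simp, by rw [if_pos hlt], fun x hx => ?_⟩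
        rcases List.mem_cons.1 hx with rfl | hx
        · exact le_rfl
        · exact hlt.le.trans (hmin x hx)
      · refine ⟨w, by simp [hw], by rw [if_neg hlt], fun x hx => ?_⟩
        rcases List.mem_cons.1 hx with rfl | hx
        · exact not_lt.1 hlt
        · exact hmin x hx

theorem assigned_iff {V : List β} {h : List (β × β)} {v : β} :
    assigned V h v = true ↔ ∃ u ∈ V, owner h u = some v := by simp [assigned]

/-- Either all bidders own an item, or one that does not bids. -/
theorem bid_spec (V : List β) (adm : β → β → Bool) (h : List (β × β)) :
    (bid V adm h = h ∧ ∀ v ∈ V, assigned V h v = true) ∨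
      ∃ v ∈ V, assigned V h v = false ∧ ((bid V adm h = h ∧ ∀ u ∈ V, ¬ adm v u) ∨
        ∃ u ∈ V, adm v u = true ∧ bid V adm h = (v, u) :: h ∧
          ∀ w ∈ V, adm v w = true → price h u ≤ price h w) := by
  cases hf : V.find? fun v => !assigned V h v with
  | none =>
    left
    refine ⟨by rw [bid, hf]; rfl, ?_⟩
    simpa using hf
  | some v =>
    right
    have hv : assigned V h v = false := by simpa using List.find?_some hf
    have hb : bid V adm h = (cheapest h (V.filter fun u => adm v u)).elim h
      fun u => (v, u) :: h := by rw [bid, hf]; rfl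
    refine ⟨v, List.mem_of_find?_eq_some hf, hv, ?_⟩
    rcases cheapest_spec h (V.filter fun u => adm v u) with ⟨he, hn⟩ | ⟨u, hu, hs, hmin⟩
    · left
      refine ⟨by rw [hb, hn]; rfl, ?_⟩
      simpa using he
    · right
      rw [List.mem_filter] at hu
      exact ⟨u, hu.1, hu.2, by rw [hb, hs]; rfl, fun w hw hvw => hmin w (by simp [hw, hvw])⟩

/-- The invariant of the auction. -/
structure Inv (V : List β) (adm : β → β → Bool) (h : List (β × β)) : Prop where
  mem : ∀ v u, (v, u) ∈ h → v ∈ V ∧ u ∈ V ∧ adm v u = true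
  inj : ∀ u u' v, owner h u = some v → owner h u' = some v → u = u'
  -- The owned item was a cheapest one when it was bid for, the bid raised its price by one, and
  -- other prices never fall.
  slack : ∀ u v, owner h u = some v → ∀ w ∈ V, adm v w = true → price h u ≤ price h w + 1

theorem sz_bid_le [Enc β] (V : List β) (adm : β → β → Bool) (h : List (β × β)) :
    sz (bid V adm h) ≤ sz h + (2 * sz V + 2) := by
  rcases bid_spec V adm h with ⟨hb, -⟩ | ⟨v, hv, -, ⟨hb, -⟩ | ⟨u, hu, -, hb, -⟩⟩
  · rw [hb]; omega
  · rw [hb]; omega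
  · have := sz_le_of_mem hv
    have := sz_le_of_mem hu
    rw [hb, sz_cons, sz_prod]
    dsimp only
    omega

variable {V : List β} {adm : β → β → Bool}

/-- The bidder owned nothing before, so nobody owns two items afterwards. The new owner has `slack`
by minimality of the price; for the other owners only the right-hand side can grow. -/
theorem Inv.bid {h : List (β × β)} (hi : Inv V adm h) : Inv V adm (bid V adm h) := by
  rcases bid_spec V adm h with ⟨hb, -⟩ | ⟨v, hv, hva, ⟨hb, -⟩ | ⟨u, hu, hvu, hb, hmin⟩⟩
  · rwa [hb]
  · rwa [hb]
  rw [hb]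
  have hno : ∀ w, owner h w ≠ some v := fun w hw => by
    have := assigned_iff.2 ⟨w, (hi.mem v w (mem_of_owner hw)).2.1, hw⟩
    simp [hva] at this
  refine ⟨?_, ?_, ?_⟩
  · intro v' u' h'
    rcases List.mem_cons.1 h' with h' | h'
    · cases h'
      exact ⟨hv, hu, hvu⟩
    · exact hi.mem v' u' h'
  · intro u₁ u₂ v' h₁ h₂
    rw [owner_cons] at h₁ h₂
    split_ifs at h₁ h₂ with h₃ h₄ h₄
    · exact h₃.symm.trans h₄
    · cases h₁; exact absurd h₂ (hno _)
    · cases h₂; exact absurd h₁ (hno _)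
    · exact hi.inj _ _ _ h₁ h₂
  · intro u₁ v₁ h₁ w hw hvw
    rw [owner_cons] at h₁
    rw [price_cons, price_cons]
    split_ifs at h₁ with h₃
    · cases h₁
      subst h₃
      have := hmin w hw hvw
      rw [if_pos rfl]
      omega
    · rw [if_neg h₃]
      have := hi.slack u₁ v₁ h₁ w hw hvw
      omega

theorem inv_nil : Inv V adm [] := ⟨by simp, by simp, by simp⟩

theorem inv_iterate (i : ℕ) : Inv V adm ((Auction.bid V adm)^[i] []) := by
  induction i with
  | zero => exact inv_nil
  | succ i ih => rw [Function.iterate_succ_apply']; exact ih.bid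

/-- If there is a perfect matching, a bidder without an item has a cheap admissible item. -/
theorem Inv.exists_price_lt {h : List (β × β)} (hi : Inv V adm h) {φ : β → β}
    (hφ : ∀ v ∈ V, φ v ∈ V ∧ adm v (φ v) = true) (hinj : Set.InjOn φ {v | v ∈ V}) {v₀ : β}
    (hv₀ : v₀ ∈ V) (hva : assigned V h v₀ = false) :
    ∃ u ∈ V, adm v₀ u = true ∧ price h u < V.toFinset.card := by
  by_contra! hcon
  let T := V.toFinset.card
  -- Suppose that all admissible items of `v₀` cost at least `T`. The set `S j` of bidders whose
  -- admissible items all cost at least `T - j` contains `v₀` and gains a member with every `j`, so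
  -- `S T` would have more than `T` elements.
  let S : ℕ → Finset β := fun j => V.toFinset.filter fun v =>
    ∀ u ∈ V, adm v u = true → T ≤ price h u + j
  have hS : ∀ j v, v ∈ S j ↔ v ∈ V ∧ ∀ u ∈ V, adm v u = true → T ≤ price h u + j := by
    simp [S]
  have key : ∀ j ≤ T, j + 1 ≤ (S j).card := by
    intro j
    induction j with
    | zero =>
      intro _
      exact Finset.card_pos.2 ⟨v₀, (hS _ _).2 ⟨hv₀, hcon⟩⟩
    | succ j ih =>
      intro hj
      have h₁ := ih (by omega)
      -- As `j < T`, the partner `φ v` has a positive price and hence an owner.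
      have h₂ : ∀ v ∈ S j, ∃ w, owner h (φ v) = some w := fun v hv => by
        rw [hS] at hv
        have := hv.2 (φ v) (hφ v hv.1).1 (hφ v hv.1).2
        exact exists_owner_of_price_pos (by omega)
      choose! ω hω using h₂
      have h₃ : ((S j).image ω).card = (S j).card := by
        refine Finset.card_image_of_injOn fun v hv v' hv' he => ?_
        have h₄ := hω v hv
        have h₅ := hω v' hv'
        rw [he] at h₄
        exact hinj ((hS _ _).1 hv).1 ((hS _ _).1 hv').1 (hi.inj _ _ _ h₄ h₅)
      have h₆ : v₀ ∉ (S j).image ω := by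
        rw [Finset.mem_image]
        rintro ⟨v, hv, hv'⟩
        have := assigned_iff.2 ⟨φ v, (hφ v ((hS _ _).1 hv).1).1, hv' ▸ hω v hv⟩
        simp [hva] at this
      -- By `slack`, the owner of an item of price at least `T - j` has no admissible item cheaper
      -- than `T - j - 1`. These owners are as many as `S j`, and `v₀`, owning nothing, is not among
      -- them.
      have h₇ : insert v₀ ((S j).image ω) ⊆ S (j + 1) := by
        intro w hw
        rw [hS]
        rcases Finset.mem_insert.1 hw with rfl | hw
        · exact ⟨hv₀, fun u hu hvu => (hcon u hu hvu).trans (by omega)⟩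
        · obtain ⟨v, hv, rfl⟩ := Finset.mem_image.1 hw
          have h₈ := hω v hv
          refine ⟨(hi.mem _ _ (mem_of_owner h₈)).1, fun u hu hvu => ?_⟩
          have h₉ := hi.slack _ _ h₈ u hu hvu
          rw [hS] at hv
          have := hv.2 (φ v) (hφ v hv.1).1 (hφ v hv.1).2
          omega
      have h₈ := Finset.card_le_card h₇
      rw [Finset.card_insert_of_notMem h₆, h₃] at h₈
      omega
  have h₁ := key T le_rfl
  have h₂ := Finset.card_le_card (Finset.filter_subset (fun v =>
    ∀ u ∈ V, adm v u = true → T ≤ price h u + T) V.toFinset)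
  exact absurd (h₁.trans h₂) (by simp [T])

theorem length_eq_sum_price (h : List (β × β)) (hm : ∀ v u, (v, u) ∈ h → u ∈ V) :
    h.length = ∑ u ∈ V.toFinset, price h u := by
  induction h with
  | nil => simp [price]
  | cons p h ih =>
    obtain ⟨v, u⟩ := p
    have hu := hm v u (by simp)
    simp only [price_cons, Finset.sum_add_distrib, List.length_cons]
    rw [← ih fun v u h => hm v u (by simp [h])]
    simp [hu]

/-- If all bidders are served, mapping each to an item it owns is injective, since an item has one
owner. Conversely, a perfect matching keeps all prices at most the number of bidders, while every
round adds a bid until all are served. An auction still unfinished at the end would have made more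
bids than the prices sum to. -/
theorem perfect_iff : perfect V adm = true ↔
    ∃ φ : β → β, (∀ v ∈ V, φ v ∈ V ∧ adm v (φ v) = true) ∧ Set.InjOn φ {v | v ∈ V} := by
  constructor
  · intro h
    have hi := inv_iterate (V := V) (adm := adm) (V.flatMap fun v => v :: V).length
    rw [perfect, List.all_eq_true] at h
    have h₁ : ∀ v, v ∈ V → _ := fun v hv => assigned_iff.1 (h v hv)
    choose! φ h₂ h₃ using h₁
    refine ⟨φ, fun v hv => ⟨h₂ v hv, (hi.mem _ _ (mem_of_owner (h₃ v hv))).2.2⟩,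
      fun v hv v' hv' he => ?_⟩
    have h₄ := h₃ v hv
    rw [he, h₃ v' hv'] at h₄
    exact (Option.some.inj h₄).symm
  · rintro ⟨φ, hφ, hinj⟩
    by_contra hcon
    have key : ∀ i, (∀ u, price ((bid V adm)^[i] []) u ≤ V.toFinset.card) ∧
        (((bid V adm)^[i] []).length = i ∨
          ∀ v ∈ V, assigned V ((bid V adm)^[i] []) v = true) := by
      intro i
      induction i with
      | zero => exact ⟨fun u => Nat.zero_le _, .inl rfl⟩
      | succ i ih =>
        have hi := inv_iterate (V := V) (adm := adm) i
        rw [Function.iterate_succ_apply']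
        generalize (bid V adm)^[i] [] = h at ih hi ⊢
        rcases bid_spec V adm h with ⟨hb, ha⟩ | ⟨v, hv, hva, ⟨hb, hn⟩ | ⟨u, hu, hvu, hb, hmin⟩⟩
        · rw [hb]
          exact ⟨ih.1, .inr ha⟩
        · exact absurd (hφ v hv).2 (hn _ (hφ v hv).1)
        · rw [hb]
          constructor
          · intro w
            rw [price_cons]
            split_ifs with huw
            · obtain ⟨w', hw', hvw', hlt⟩ := hi.exists_price_lt hφ hinj hv hva
              have := hmin w' hw' hvw'
              subst huw
              omega
            · exact ih.1 w
          · left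
            rcases ih.2 with hl | hl
            · rw [List.length_cons, hl]
            · rw [hl v hv] at hva
              cases hva
    obtain ⟨h₁, h₂⟩ := key (V.flatMap fun v => v :: V).length
    have hi := inv_iterate (V := V) (adm := adm) (V.flatMap fun v => v :: V).length
    rcases h₂ with h₂ | h₂
    · rw [length_eq_sum_price _ fun v u h => (hi.mem v u h).2.1] at h₂
      have h₃ := Finset.sum_le_card_nsmul V.toFinset _ _ fun u _ => h₁ u
      rw [h₂] at h₃
      simp only [List.length_flatMap, List.length_cons, List.map_const', List.sum_replicate,
        smul_eq_mul] at h₃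
      have h₄ := V.toFinset_card_le
      rcases V.eq_nil_or_concat with rfl | ⟨l, a, hl⟩
      · exact hcon (by simp [perfect])
      · have h₅ : 0 < V.length := by simp [hl]
        have := Nat.mul_le_mul h₄ h₄
        rw [mul_add] at h₃
        omega
    · exact hcon (by simpa [perfect] using h₂)

end Auction

namespace PolyTime

open Auction

variable {α β : Type} [Enc α] [Enc β] [Inj β] [DecidableEq β]

@[fun_prop]
theorem owner {h : α → List (β × β)} {u : α → β} (hh : PolyTime h) (hu : PolyTime u) :
    PolyTime fun a => owner (h a) (u a) := by
  unfold Auction.owner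
  exact optionElim (find? hh (decide_eq id.snd.snd (comp hu id.fst))) (const _) (by fun_prop)

@[fun_prop]
theorem price {h : α → List (β × β)} {u : α → β} (hh : PolyTime h) (hu : PolyTime u) :
    PolyTime fun a => price (h a) (u a) := by
  unfold Auction.price
  exact length (filter hh (decide_eq id.snd.snd (comp hu id.fst)))

@[fun_prop]
theorem assigned {V : α → List β} {h : α → List (β × β)} {v : α → β} (hV : PolyTime V)
    (hh : PolyTime h) (hv : PolyTime v) : PolyTime fun a => assigned (V a) (h a) (v a) := by
  unfold Auction.assigned
  exact any hV (decide_eq (owner (comp hh id.fst) id.snd) (some (comp hv id.fst)))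

@[fun_prop]
theorem cheapest {h : α → List (β × β)} {l : α → List β} (hh : PolyTime h) (hl : PolyTime l) :
    PolyTime fun a => cheapest (h a) (l a) := by
  obtain ⟨u, hu⟩ := hl.exists_sz_le
  unfold Auction.cheapest
  refine foldr hl (const none) (f := fun a u o => o.elim (Option.some u) fun w =>
    if Auction.price (h a) u < Auction.price (h a) w then Option.some u else Option.some w) ?_
    (u + 2) fun a s b hb => ?_
  · refine optionElim (by fun_prop) (by fun_prop) (ite (decide_lt (price ?_ ?_) (price ?_ ?_))
      ?_ ?_)
    · exact comp hh id.fst.fst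
    · fun_prop
    · exact comp hh id.fst.fst
    all_goals fun_prop
  · have := sz_le_of_mem hb
    have := hu a
    cases s with
    | none => simp; omega
    | some w =>
      simp only [Option.elim_some, Polynomial.eval_add, Polynomial.eval_ofNat]
      split_ifs
      · rw [sz_some]; omega
      · omega

theorem bid {V : α → List β} {adm : α → β → β → Bool} {h : α → List (β × β)} (hV : PolyTime V)
    (hadm : PolyTime fun p : α × β × β => adm p.1 p.2.1 p.2.2) (hh : PolyTime h) :
    PolyTime fun a => bid (V a) (adm a) (h a) := by
  unfold Auction.bid
  refine optionElim (find? hV (not (assigned (comp hV id.fst) (comp hh id.fst) id.snd))) hh ?_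
  refine optionElim (cheapest (comp hh id.fst) (filter (comp hV id.fst) ?_)) (comp hh id.fst) ?_
  · exact comp hadm (id.fst.fst.pair (id.fst.snd.pair id.snd))
  · exact cons (id.fst.snd.pair id.snd) (comp hh id.fst.fst)

/-- The size of the history grows by at most `2 * sz V + 2` per round (`sz_bid_le`), so all
intermediate values are polynomially bounded. -/
theorem perfect {V : α → List β} {adm : α → β → β → Bool} (hV : PolyTime V)
    (hadm : PolyTime fun p : α × β × β => adm p.1 p.2.1 p.2.2) :
    PolyTime fun a => perfect (V a) (adm a) := by
  have hn : PolyTime fun a => (V a).flatMap fun v => v :: V a :=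
    flatMap hV (cons id.snd (comp hV id.fst))
  obtain ⟨n, h_n⟩ := hn.exists_sz_le
  obtain ⟨u, hu⟩ := hV.exists_sz_le
  let g : List (β × β) × α → List (β × β) × α := fun p =>
    (Auction.bid (V p.2) (adm p.2) p.1, p.2)
  have hg : PolyTime g := pair (bid (adm := fun p : List (β × β) × α => adm p.2)
    (comp hV id.snd) (comp hadm (id.fst.snd.pair id.snd)) id.fst) id.snd
  have key : ∀ a i, g^[i] ([], a) = ((Auction.bid (V a) (adm a))^[i] [], a) := by
    intro a i
    induction i with
    | zero => rfl
    | succ i ih => rw [Function.iterate_succ_apply', ih, Function.iterate_succ_apply']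
  have hsz : ∀ a i, sz ((Auction.bid (V a) (adm a))^[i] []) ≤ 1 + i * (2 * sz (V a) + 2) := by
    intro a i
    induction i with
    | zero => simp
    | succ i ih =>
      rw [Function.iterate_succ_apply', add_mul]
      have := sz_bid_le (V a) (adm a) ((Auction.bid (V a) (adm a))^[i] [])
      omega
  have h₁ := iterate_length hn (pair (const []) id) hg (2 + .X + n * (2 * u + 2)) fun a i hi => by
    rw [key, sz_prod]
    have h₂ := hsz a i
    have h₃ : i ≤ n.eval (sz a) := hi.trans ((length_lt_sz _).le.trans (h_n a))
    have h₄ := Nat.mul_le_mul h₃ (show 2 * sz (V a) + 2 ≤ 2 * u.eval (sz a) + 2 by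
      have := hu a; omega)
    simp only [Polynomial.eval_add, Polynomial.eval_mul, Polynomial.eval_ofNat, Polynomial.eval_X]
    omega
  have h₂ := comp h₁.fst (f := fun p : α × β => p.1) id.fst
  refine of_enc_eq_comp (all hV (f := fun a v => Auction.assigned (V a)
    (g^[((V a).flatMap fun v => v :: V a).length] ([], a)).1 v) (assigned (comp hV id.fst) h₂ id.snd))
    fun a => ?_
  simp only [key]
  rfl

end PolyTime

/-! ### Witnesses of simulation and perfect matchings -/

namespace ShEx

namespace Basic

/-- The lower end point is `1`. -/
def req : Basic → Bool
  | one => true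
  | opt => false
  | plus => true
  | star => false

/-- The upper end point is `∞`. -/
def unb : Basic → Bool
  | one => false
  | opt => false
  | plus => true
  | star => true

/-- An edge occurring as in `M` may be the distinguished edge mapped to one occurring as in `N`. -/
def compat (M N : Basic) : Bool :=
  -- The first two factors compare the end points. The third excludes `*`, which imposes no
  -- condition and needs no distinguished edge.
  (!N.req || M.req) && (N.unb || !M.unb) && (N.req || !N.unb)

theorem lo_toInterval (M : Basic) : M.toInterval.lo = if M.req then 1 else 0 := by
  cases M <;> rfl

theorem hi_toInterval (M : Basic) : M.toInterval.hi = if M.unb then ⊤ else 1 := by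
  cases M <;> rfl

theorem one_le_hi (M : Basic) : 1 ≤ M.toInterval.hi := by
  rw [hi_toInterval]
  split_ifs <;> simp

end Basic

theorem Interval.lo_sum {ι : Type*} (s : Finset ι) (f : ι → Interval) :
    (∑ i ∈ s, f i).lo = ∑ i ∈ s, (f i).lo := by
  classical
  induction s using Finset.induction_on with
  | empty => rfl
  | insert a s ha ih => rw [Finset.sum_insert ha, Finset.sum_insert ha, ← ih]; rfl

theorem Interval.hi_sum {ι : Type*} (s : Finset ι) (f : ι → Interval) :
    (∑ i ∈ s, f i).hi = ∑ i ∈ s, (f i).hi := by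
  classical
  induction s using Finset.induction_on with
  | empty => rfl
  | insert a s ha ih => rw [Finset.sum_insert ha, Finset.sum_insert ha, ← ih]; rfl

/-- Lower end points are 0 or 1, so their sum reaches 1 as soon as one of them does. Upper end
points are at least 1, so their sum stays within 1 only for at most one summand, and that one
bounded. -/
theorem sum_toInterval_subset_iff {A : Type*} (s : Finset A) (M : A → Basic) (N : Basic) :
    (∑ a ∈ s, (M a).toInterval) ⊆ N.toInterval ↔
      (N.req = true → ∃ a ∈ s, (M a).req = true) ∧
      (N.unb = false → (∀ a ∈ s, (M a).unb = false) ∧ ∀ a ∈ s, ∀ a' ∈ s, a = a') := by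
  classical
  rw [Interval.subset_iff, Interval.lo_sum, Interval.hi_sum]
  apply and_congr
  · rw [Basic.lo_toInterval]
    split_ifs with h
    · rw [Nat.one_le_iff_ne_zero, Ne, Finset.sum_eq_zero_iff]
      simp [h, Basic.lo_toInterval]
    · simp [h]
  · rw [Basic.hi_toInterval]
    split_ifs with h
    · simp [h]
    · simp only [h, forall_const]
      constructor
      · intro hs
        refine ⟨fun a ha => ?_, fun a ha a' ha' => ?_⟩
        · have := (Finset.single_le_sum (fun i _ => zero_le) ha).trans hs
          by_contra hu
          rw [Basic.hi_toInterval, if_pos (Bool.eq_true_of_not_eq_false hu)] at this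
          exact absurd this (by decide)
        · by_contra hne
          have h₁ : ∑ i ∈ {a, a'}, (M i).toInterval.hi ≤ 1 :=
            (Finset.sum_le_sum_of_subset (by simp [Finset.insert_subset_iff, ha, ha'])).trans hs
          rw [Finset.sum_pair hne] at h₁
          have h₂ := add_le_add (M a).one_le_hi (M a').one_le_hi
          exact absurd (h₂.trans h₁) (by decide)
      · rintro ⟨h₁, h₂⟩
        rcases s.eq_empty_or_nonempty with rfl | ⟨a, ha⟩
        · simp
        · have : s = {a} := Finset.eq_singleton_iff_unique_mem.2 ⟨ha, fun b hb => h₂ b hb a ha⟩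
          rw [this, Finset.sum_singleton, Basic.hi_toInterval, h₁ a ha]
          simp

/-- Edges that are matched with each other, or left unmatched. -/
def Adm {A B : Type} (M : A → Basic) (N : B → Basic) (ok : A → B → Prop) : A ⊕ B → A ⊕ B → Prop
  | .inl a, .inl a' => a = a' ∧ ∃ b, ok a b ∧ (N b).unb = true
  | .inl a, .inr b => ok a b ∧ (M a).compat (N b) = true
  | .inr b, .inl a => ok a b ∧ (M a).compat (N b) = true
  | .inr b, .inr b' => b = b' ∧ (N b).req = false

open Classical in
/-- Witnesses exist if and only if perfect matchings exist. -/
theorem exists_witness_iff {A B : Type} [Fintype A] [Finite B] (M : A → Basic) (N : B → Basic)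
    (ok : A → B → Prop) :
    (∃ w : A → B, (∀ a, ok a (w a)) ∧ ∀ b, (∑ a with w a = b, (M a).toInterval) ⊆
      (N b).toInterval) ↔
    ∃ ψ : A ⊕ B → A ⊕ B, Function.Injective ψ ∧ ∀ x, Adm M N ok x (ψ x) := by
  simp only [sum_toInterval_subset_iff, Finset.mem_filter, Finset.mem_univ, true_and]
  constructor
  · rintro ⟨w, hok, hw⟩
    choose r hrw hr using fun b => (hw b).1
    -- The distinguished edges: the only edge of the fibre if `w a` is bounded, and otherwise the
    -- chosen required edge `r (w a)`, which exists only if `w a` is required.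
    let P : A → Prop := fun a => (N (w a)).unb = false ∨ ∃ h, r (w a) h = a
    have hP_r : ∀ b h, P (r b h) := fun b h => by
      have : ∀ b', b' = b → ∃ h', r b' h' = r b h := by
        rintro _ rfl
        exact ⟨h, rfl⟩
      exact .inr (this _ (hrw b h))
    have hP_inj : ∀ a a', P a → P a' → w a = w a' → a = a' := by
      intro a a' ha ha' he
      by_cases hu : (N (w a)).unb = false
      · exact ((hw (w a)).2 hu).2 a rfl a' he.symm
      · obtain ⟨h, ha⟩ := ha.resolve_left hu
        obtain ⟨h', ha'⟩ := ha'.resolve_left (he ▸ hu)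
        rw [← ha, ← ha']
        congr 1
    have hP_compat : ∀ a, P a → (M a).compat (N (w a)) = true := by
      intro a ha
      have h₁ : (N (w a)).req = true → (M a).req = true := fun h => by
        rw [hP_inj a (r (w a) h) ha (hP_r _ h) (hrw _ h).symm]
        exact hr _ h
      have h₂ : (N (w a)).unb = false → (M a).unb = false := fun h => ((hw _).2 h).1 a rfl
      have h₃ : (N (w a)).unb = false ∨ (N (w a)).req = true := ha.imp_right fun h => h.1
      unfold Basic.compat
      revert h₁ h₂ h₃
      cases (N (w a)).req <;> cases (N (w a)).unb <;> cases (M a).req <;> cases (M a).unb <;> simp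
    -- The involution that exchanges every distinguished edge with its image and fixes the rest.
    let ψ : A ⊕ B → A ⊕ B := fun x => match x with
      | .inl a => if P a then .inr (w a) else .inl a
      | .inr b => if h : ∃ a, P a ∧ w a = b then .inl h.choose else .inr b
    have hψ_inl : ∀ a, P a → ψ (.inl a) = .inr (w a) := fun a h => if_pos h
    have hψ_inr : ∀ a, P a → ψ (.inr (w a)) = .inl a := fun a h => by
      have h' : ∃ a', P a' ∧ w a' = w a := ⟨a, h, rfl⟩
      have h₁ : ψ (.inr (w a)) = .inl h'.choose := dif_pos h'
      rw [h₁, hP_inj _ a h'.choose_spec.1 h h'.choose_spec.2]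
    have hψ_inl' : ∀ a, ¬P a → ψ (.inl a) = .inl a := fun a h => if_neg h
    have hψ_inr' : ∀ b, (¬∃ a, P a ∧ w a = b) → ψ (.inr b) = .inr b := fun b h => dif_neg h
    refine ⟨ψ, Function.Involutive.injective ?_, ?_⟩
    · rintro (a | b)
      · by_cases ha : P a
        · rw [hψ_inl a ha, hψ_inr a ha]
        · rw [hψ_inl' a ha, hψ_inl' a ha]
      · by_cases hb : ∃ a, P a ∧ w a = b
        · obtain ⟨a, ha, rfl⟩ := hb
          rw [hψ_inr a ha, hψ_inl a ha]
        · rw [hψ_inr' b hb, hψ_inr' b hb]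
    · rintro (a | b)
      · by_cases ha : P a
        · rw [hψ_inl a ha]
          exact ⟨hok a, hP_compat a ha⟩
        · rw [hψ_inl' a ha]
          refine ⟨rfl, w a, hok a, ?_⟩
          by_contra hu
          exact ha (.inl (by simpa using hu))
      · by_cases hb : ∃ a, P a ∧ w a = b
        · obtain ⟨a, ha, rfl⟩ := hb
          rw [hψ_inr a ha]
          exact ⟨hok a, hP_compat a ha⟩
        · rw [hψ_inr' b hb]
          refine ⟨rfl, ?_⟩
          by_contra hreq
          have h := Bool.eq_true_of_not_eq_false hreq
          exact hb ⟨r b h, hP_r b h, hrw b h⟩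
  · rintro ⟨ψ, hinj, hψ⟩
    -- Since `ψ` need not be an involution, `w` is read off from its values on `A` only. A required
    -- `b` may not be fixed by `ψ`, so by surjectivity it is the image of some `a`; over a bounded
    -- `b`, injectivity leaves at most one edge.
    have hsurj := Finite.surjective_of_injective hinj
    have h₁ : ∀ a, ∃ b, ok a b ∧ (ψ (.inl a) = .inr b ∨ (N b).unb = true) ∧
        ∀ b', ψ (.inl a) = .inr b' → b' = b := by
      intro a
      have := hψ (.inl a)
      cases h : ψ (.inl a) with
      | inl a' =>
        rw [h] at this
        obtain ⟨-, b, hb⟩ := this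
        exact ⟨b, hb.1, .inr hb.2, by simp⟩
      | inr b =>
        rw [h] at this
        exact ⟨b, this.1, .inl rfl, fun b' hb' => (Sum.inr.inj hb').symm⟩
    choose w hok hw hw' using h₁
    refine ⟨w, hok, fun b => ⟨fun hb => ?_, fun hb => ⟨fun a ha => ?_, fun a ha a' ha' => ?_⟩⟩⟩
    · obtain ⟨x, hx⟩ := hsurj (.inr b)
      have h₂ := hψ x
      rw [hx] at h₂
      cases x with
      | inl a =>
        refine ⟨a, (hw' a b hx).symm, ?_⟩
        have := h₂.2
        simp only [Basic.compat, hb] at this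
        simp_all
      | inr b' =>
        obtain ⟨rfl, h₃⟩ := h₂
        rw [h₃] at hb
        cases hb
    · subst ha
      have h₂ := hψ (.inl a)
      rw [(hw a).resolve_right (by simp [hb])] at h₂
      have := h₂.2
      simp only [Basic.compat, hb] at this
      simp_all
    · have h₂ := (hw a).resolve_right (by simp [ha, hb])
      have h₃ := (hw a').resolve_right (by simp [ha', hb])
      rw [ha] at h₂
      rw [ha', ← h₂] at h₃
      exact (Sum.inl.inj (hinj h₃)).symm

end ShEx

/-! ### Deciding the existence of embeddings -/

open Enc

namespace Auction

/-- Transfers `perfect_iff` to a type `X` that `e` identifies with the entries of `V`; values of a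
matching outside `V` are irrelevant. -/
theorem perfect_iff_of_embedding {X β : Type} [DecidableEq β] {V : List β} {adm : β → β → Bool}
    {e : X → β} (he : Function.Injective e) (hV : ∀ b, b ∈ V ↔ ∃ x, e x = b) {Adm : X → X → Prop}
    (hadm : ∀ x y, adm (e x) (e y) = true ↔ Adm x y) :
    perfect V adm = true ↔ ∃ ψ : X → X, Function.Injective ψ ∧ ∀ x, Adm x (ψ x) := by
  rw [perfect_iff]
  constructor
  · rintro ⟨φ, hφ, hinj⟩
    have h : ∀ x, ∃ y, e y = φ (e x) := fun x => (hV _).1 (hφ (e x) ((hV _).2 ⟨x, rfl⟩)).1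
    choose ψ hψ using h
    refine ⟨ψ, fun x y hxy => he (hinj ((hV _).2 ⟨x, rfl⟩) ((hV _).2 ⟨y, rfl⟩) ?_), fun x => ?_⟩
    · rw [← hψ, ← hψ, hxy]
    · rw [← hadm, hψ]
      exact (hφ (e x) ((hV _).2 ⟨x, rfl⟩)).2
  · rintro ⟨ψ, hinj, hψ⟩
    refine ⟨Function.extend e (e ∘ ψ) fun b => b, fun v hv => ?_, fun v hv v' hv' h => ?_⟩
    · obtain ⟨x, rfl⟩ := (hV v).1 hv
      rw [he.extend_apply]
      exact ⟨(hV _).2 ⟨_, rfl⟩, (hadm _ _).2 (hψ x)⟩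
    · obtain ⟨x, rfl⟩ := (hV v).1 hv
      obtain ⟨y, rfl⟩ := (hV v').1 hv'
      rw [he.extend_apply, he.extend_apply] at h
      rw [hinj (he h)]

end Auction

namespace ShEx

/-- A number for each basic interval. -/
def Basic.code : Basic → ℕ
  | one => 0
  | opt => 1
  | plus => 2
  | star => 3

theorem Basic.code_injective : Function.Injective Basic.code := by
  rintro (_ | _ | _ | _) (_ | _ | _ | _) <;> simp [code]

instance : Finite Basic := Finite.of_injective (fun s => (⟨s.code, by
    rcases s with (_ | _ | _ | _) <;> simp [Basic.code]⟩ : Fin 4))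
  fun _ _ h => Basic.code_injective (Fin.mk.inj h)

instance : Enc Basic := ⟨fun s => enc s.code⟩

instance : Inj Basic := ⟨fun _ _ h => Basic.code_injective (Inj.inj h)⟩

/-- The data of an edge: source, target, interval and label. -/
abbrev EdgeData : Type := (ℕ × ℕ) × Basic × List Bool

/-- The data of a graph: the number of nodes and the list of edges. -/
abbrev GraphData : Type := ℕ × List EdgeData

namespace EdgeData

/-- The edge of number `i` in a list. -/
def get (E : List EdgeData) (i : ℕ) : EdgeData := E.getD i ((0, 0), .one, [])

/-- The numbers of the outgoing edges of a node. -/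
def out (E : List EdgeData) (n : ℕ) : List ℕ :=
  (List.range E.length).filter fun i => decide ((get E i).1.1 = n)

/-- The labels of the edges agree, and the targets are related. -/
def ok (R : List (ℕ × ℕ)) (e f : EdgeData) : Bool :=
  decide (e.2.2 = f.2.2) && R.any fun p => decide (p = (e.1.2, f.1.2))

/-- The decision procedure for `Adm`. Edges of the first graph are tagged by `true`, and edges of
the second one by `false`. -/
def adm (R : List (ℕ × ℕ)) (E F : List EdgeData) (m : ℕ) (x y : Bool × ℕ) : Bool :=
  if x.1 = true then
    if y.1 = true then decide (x.2 = y.2) && (out F m).any fun j =>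
      ok R (get E x.2) (get F j) && (get F j).2.1.unb
    else ok R (get E x.2) (get F y.2) && (get E x.2).2.1.compat (get F y.2).2.1
  else
    if y.1 = true then ok R (get E y.2) (get F x.2) && (get E y.2).2.1.compat (get F x.2).2.1
    else decide (x.2 = y.2) && !(get F y.2).2.1.req

/-- The decision procedure for the existence of witnesses. -/
def test (R : List (ℕ × ℕ)) (E F : List EdgeData) (p : ℕ × ℕ) : Bool :=
  Auction.perfect ((out E p.1).map (fun i => (true, i)) ++ (out F p.2).map fun j => (false, j))
    (adm R E F p.2)

/-- Remove the pairs that have no witness. -/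
def prune (E F : List EdgeData) (R : List (ℕ × ℕ)) : List (ℕ × ℕ) := R.filter (test R E F)

end EdgeData

namespace GraphData

open EdgeData

/-- All pairs of nodes. -/
def pairs (G H : GraphData) : List (ℕ × ℕ) :=
  (List.range G.1).flatMap fun n => (List.range H.1).map fun m => (n, m)

/-- The greatest simulation. -/
def sim (G H : GraphData) : List (ℕ × ℕ) :=
  (prune G.2 H.2)^[(pairs G H).length] (pairs G H)

/-- The decision procedure for the existence of embeddings. -/
def embeds (G H : GraphData) : Bool :=
  (List.range G.1).all fun n => (sim G H).any fun p => decide (p.1 = n)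

end GraphData

/-- The data of a shape graph. -/
def ShapeGraph.data (G : ShapeGraph) : GraphData :=
  (G.numNodes, List.ofFn fun e => ((↑(G.source e), ↑(G.target e)), G.occ e, G.lab e))

namespace ShapeGraph

open EdgeData GraphData

theorem get_data (G : ShapeGraph) (e : Fin G.numEdges) :
    EdgeData.get G.data.2 e = ((↑(G.source e), ↑(G.target e)), G.occ e, G.lab e) := by
  simp [EdgeData.get, data]

theorem mem_out_data (G : ShapeGraph) (n : Fin G.numNodes) (i : ℕ) :
    i ∈ out G.data.2 n ↔ ∃ e : G.toGraph.Out n, (e.1 : ℕ) = i := by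
  constructor
  · intro h
    simp only [out, List.mem_filter, List.mem_range, decide_eq_true_eq] at h
    obtain ⟨h₁, h₂⟩ := h
    have h₃ : i < G.numEdges := by simpa [data] using h₁
    have h₄ := G.get_data ⟨i, h₃⟩
    dsimp only at h₄
    rw [h₄] at h₂
    exact ⟨⟨⟨i, h₃⟩, Fin.ext h₂⟩, rfl⟩
  · rintro ⟨⟨e, he⟩, rfl⟩
    have he : G.source e = n := he
    simp only [out, List.mem_filter, List.mem_range, decide_eq_true_eq, get_data]
    exact ⟨by simp [data], by rw [he]⟩

/-- Tagged edge numbers embed the disjoint union of the two sets of outgoing edges, and under this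
embedding `adm` decides `Adm`. -/
theorem test_iff (G H : ShapeGraph) (R : List (ℕ × ℕ)) (n : Fin G.numNodes) (m : Fin H.numNodes) :
    test R G.data.2 H.data.2 (n, m) = true ↔
      ∃ w, G.toGraph.IsWitness H.toGraph (fun a b => (↑a, ↑b) ∈ R) n m w := by
  let okP : G.toGraph.Out n → H.toGraph.Out m → Prop := fun e f =>
    G.lab e.1 = H.lab f.1 ∧ ((G.target e.1 : ℕ), (H.target f.1 : ℕ)) ∈ R
  have hok : ∀ e f, ok R ((↑(G.source e.1), ↑(G.target e.1)), G.occ e.1, G.lab e.1)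
      ((↑(H.source f.1), ↑(H.target f.1)), H.occ f.1, H.lab f.1) = true ↔ okP e f := by
    intro e f
    simp [ok, okP]
  -- Matches the classical instance over which `IsWitness` sums.
  let _ : DecidablePred fun e => G.toGraph.source e = n := fun _ => Classical.propDecidable _
  have h₁ := exists_witness_iff (fun e : G.toGraph.Out n => G.occ e.1)
    (fun f : H.toGraph.Out m => H.occ f.1) okP
  let e : G.toGraph.Out n ⊕ H.toGraph.Out m → Bool × ℕ :=
    Sum.elim (fun e => (true, (e.1 : ℕ))) fun f => (false, (f.1 : ℕ))
  have he : Function.Injective e := by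
    rintro (x | x) (y | y) h
    · simpa [e, Fin.val_inj, Subtype.ext_iff] using h
    · simp [e] at h
    · simp [e] at h
    · simpa [e, Fin.val_inj, Subtype.ext_iff] using h
  have h₂ := Auction.perfect_iff_of_embedding he (V := (out G.data.2 n).map (fun i => (true, i)) ++
    (out H.data.2 m).map fun j => (false, j)) (adm := adm R G.data.2 H.data.2 m)
    (Adm := Adm (fun e : G.toGraph.Out n => G.occ e.1) (fun f : H.toGraph.Out m => H.occ f.1) okP)
    (fun b => ?_) fun x y => ?_
  · refine Iff.trans (h₂.trans h₁.symm) (exists_congr fun w => ?_)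
    simp only [Graph.IsWitness, okP, forall_and, and_assoc]
    refine and_congr Iff.rfl (and_congr Iff.rfl (forall_congr' fun f => ?_))
    convert Iff.rfl <;> rfl
  · obtain ⟨b, i⟩ := b
    cases b <;> simp [mem_out_data, e]
  · rcases x with x | x <;> rcases y with y | y
    · simp only [adm, e, Sum.elim_inl, Adm]
      simp only [if_true, get_data, Bool.and_eq_true, decide_eq_true_eq, Fin.val_inj,
        Subtype.ext_iff, List.any_eq_true, mem_out_data]
      refine and_congr Iff.rfl ⟨?_, ?_⟩
      · rintro ⟨_, ⟨f, rfl⟩, h₃, h₄⟩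
        rw [get_data] at h₃ h₄
        exact ⟨f, (hok x f).1 h₃, h₄⟩
      · rintro ⟨f, h₃, h₄⟩
        refine ⟨_, ⟨f, rfl⟩, ?_⟩
        rw [get_data]
        exact ⟨(hok x f).2 h₃, h₄⟩
    · simp [adm, e, Adm, get_data, hok]
    · simp [adm, e, Adm, get_data, hok]
    · simp only [adm, e, Sum.elim_inr, Adm]
      simp only [get_data, Subtype.ext_iff, Fin.val_inj, Bool.false_eq_true, if_false,
        Bool.and_eq_true, decide_eq_true_eq, Bool.not_eq_true']
      exact and_congr_right fun h => by rw [h]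

end ShapeGraph

namespace EdgeData

theorem prune_subset (E F : List EdgeData) (R : List (ℕ × ℕ)) : prune E F R ⊆ R :=
  List.filter_subset_self _

/-- A round that changes the list shortens it. -/
theorem prune_fixed (E F : List EdgeData) (k : ℕ) (R : List (ℕ × ℕ)) (hk : R.length ≤ k) :
    prune E F ((prune E F)^[k] R) = (prune E F)^[k] R := by
  induction k generalizing R with
  | zero =>
    obtain rfl : R = [] := by simpa using hk
    rfl
  | succ k ih =>
    by_cases h : prune E F R = R
    · rw [Function.iterate_fixed h, h]
    · refine ih _ ?_
      have h₁ : (prune E F R).length ≤ R.length := List.length_filter_le _ _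
      have h₂ : (prune E F R).length ≠ R.length := fun he =>
        h (List.filter_eq_self.2 (List.length_filter_eq_length_iff.1 he))
      omega

theorem iterate_prune_subset (E F : List EdgeData) (R : List (ℕ × ℕ)) (k : ℕ) :
    (prune E F)^[k] R ⊆ R := by
  induction k with
  | zero => exact fun _ h => h
  | succ k ih =>
    rw [Function.iterate_succ_apply']
    exact fun _ h => ih (prune_subset _ _ _ h)

end EdgeData

namespace ShapeGraph

open EdgeData GraphData

/-- A fixed point of pruning is a simulation, because each of its pairs passes the test against the
fixed point itself. Conversely, a simulation is contained in every iterate, because its witnesses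
remain witnesses for the larger current relation. -/
theorem embeds_data_iff (G H : ShapeGraph) :
    embeds G.data H.data = true ↔ G.toGraph.Embeds H.toGraph := by
  have hpairs : ∀ n m : ℕ, (n, m) ∈ pairs G.data H.data ↔ n < G.numNodes ∧ m < H.numNodes := by
    simp [pairs, data]
  constructor
  · intro h
    have hfix : prune G.data.2 H.data.2 (sim G.data H.data) = sim G.data H.data :=
      prune_fixed _ _ _ _ le_rfl
    refine ⟨fun n m => (↑n, ↑m) ∈ sim G.data H.data, fun n m hnm => ?_, fun n => ?_⟩
    · rw [← hfix] at hnm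
      exact (test_iff G H _ n m).1 (List.mem_filter.1 hnm).2
    · simp only [embeds, List.all_eq_true, List.any_eq_true, decide_eq_true_eq,
        List.mem_range] at h
      obtain ⟨⟨n', m⟩, hm, rfl⟩ := h n (by simp [data])
      have := (hpairs _ _).1 (iterate_prune_subset _ _ _ _ hm)
      exact ⟨⟨m, this.2⟩, hm⟩
  · rintro ⟨R, hR, hn⟩
    have key : ∀ i, ∀ n m, R n m →
        ((n : ℕ), (m : ℕ)) ∈ (prune G.data.2 H.data.2)^[i] (pairs G.data H.data) := by
      intro i
      induction i with
      | zero => exact fun n m _ => (hpairs _ _).2 ⟨n.2, m.2⟩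
      | succ i ih =>
        intro n m hnm
        rw [Function.iterate_succ_apply']
        refine List.mem_filter.2 ⟨ih n m hnm, (test_iff G H _ n m).2 ?_⟩
        obtain ⟨w, h₁, h₂, h₃⟩ := hR n m hnm
        exact ⟨w, h₁, fun e => ih _ _ (h₂ e), h₃⟩
    simp only [embeds, List.all_eq_true, List.any_eq_true, decide_eq_true_eq, List.mem_range]
    intro n h
    obtain ⟨m, hm⟩ := hn ⟨n, h⟩
    exact ⟨_, key _ _ _ hm, rfl⟩

end ShapeGraph

end ShEx

/-! ### The decision procedure runs in polynomial time -/

open Enc ShEx EdgeData GraphData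

namespace PolyTime

variable {α : Type} [Enc α]

@[fun_prop]
theorem req {M : α → Basic} (hM : PolyTime M) : PolyTime fun a => (M a).req := of_finite hM _

@[fun_prop]
theorem unb {M : α → Basic} (hM : PolyTime M) : PolyTime fun a => (M a).unb := of_finite hM _

@[fun_prop]
theorem compat {M N : α → Basic} (hM : PolyTime M) (hN : PolyTime N) :
    PolyTime fun a => (M a).compat (N a) := by
  unfold Basic.compat
  fun_prop

@[fun_prop]
theorem edgeGet {E : α → List EdgeData} {i : α → ℕ} (hE : PolyTime E) (hi : PolyTime i) :
    PolyTime fun a => EdgeData.get (E a) (i a) := by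
  unfold EdgeData.get
  fun_prop

@[fun_prop]
theorem out {E : α → List EdgeData} {n : α → ℕ} (hE : PolyTime E) (hn : PolyTime n) :
    PolyTime fun a => out (E a) (n a) := by
  unfold EdgeData.out
  fun_prop

@[fun_prop]
theorem ok {R : α → List (ℕ × ℕ)} {e f : α → EdgeData} (hR : PolyTime R) (he : PolyTime e)
    (hf : PolyTime f) : PolyTime fun a => ok (R a) (e a) (f a) := by
  unfold EdgeData.ok
  fun_prop

@[fun_prop]
theorem adm {R : α → List (ℕ × ℕ)} {E F : α → List EdgeData} {m : α → ℕ} {x y : α → Bool × ℕ}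
    (hR : PolyTime R) (hE : PolyTime E) (hF : PolyTime F) (hm : PolyTime m) (hx : PolyTime x)
    (hy : PolyTime y) : PolyTime fun a => adm (R a) (E a) (F a) (m a) (x a) (y a) := by
  unfold EdgeData.adm
  fun_prop

@[fun_prop]
theorem test {R : α → List (ℕ × ℕ)} {E F : α → List EdgeData} {p : α → ℕ × ℕ}
    (hR : PolyTime R) (hE : PolyTime E) (hF : PolyTime F) (hp : PolyTime p) :
    PolyTime fun a => test (R a) (E a) (F a) (p a) := by
  unfold EdgeData.test
  refine perfect (by fun_prop) ?_
  fun_prop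

@[fun_prop]
theorem prune {R : α → List (ℕ × ℕ)} {E F : α → List EdgeData}
    (hR : PolyTime R) (hE : PolyTime E) (hF : PolyTime F) :
    PolyTime fun a => prune (E a) (F a) (R a) := by
  unfold EdgeData.prune
  fun_prop

@[fun_prop]
theorem pairs {G H : α → GraphData} (hG : PolyTime G) (hH : PolyTime H) :
    PolyTime fun a => pairs (G a) (H a) := by
  unfold GraphData.pairs
  fun_prop

theorem _root_.Enc.sz_filter_le {β : Type} [Enc β] (f : β → Bool) (l : List β) :
    sz (l.filter f) ≤ sz l := by
  induction l with
  | nil => simp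
  | cons b l ih => by_cases h : f b = true <;> simp [h] <;> omega

-- Pruning never enlarges the list, so the initial state bounds all iterates; the two graphs are
-- carried along in the state.
@[fun_prop]
theorem sim {G H : α → GraphData} (hG : PolyTime G) (hH : PolyTime H) :
    PolyTime fun a => sim (G a) (H a) := by
  have hp := hG.pairs hH
  obtain ⟨u, hu⟩ := (hp.pair (hG.pair hH)).exists_sz_le
  let g : List (ℕ × ℕ) × GraphData × GraphData → List (ℕ × ℕ) × GraphData × GraphData :=
    fun p => (EdgeData.prune p.2.1.2 p.2.2.2 p.1, p.2)
  have hg : PolyTime g := by fun_prop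
  have key : ∀ p i, g^[i] p = ((EdgeData.prune p.2.1.2 p.2.2.2)^[i] p.1, p.2) := by
    intro p i
    induction i with
    | zero => rfl
    | succ i ih => rw [Function.iterate_succ_apply', ih, Function.iterate_succ_apply']
  have h := iterate_length hp (hp.pair (hG.pair hH)) hg u fun a i hi => by
    clear hi
    refine le_trans ?_ (hu a)
    induction i with
    | zero => rfl
    | succ i ih =>
      refine le_trans ?_ ih
      rw [Function.iterate_succ_apply']
      have := sz_filter_le (EdgeData.test (g^[i] (GraphData.pairs (G a) (H a), G a, H a)).1
        (g^[i] (GraphData.pairs (G a) (H a), G a, H a)).2.1.2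
        (g^[i] (GraphData.pairs (G a) (H a), G a, H a)).2.2.2)
        (g^[i] (GraphData.pairs (G a) (H a), G a, H a)).1
      rw [sz_prod, sz_prod (g^[i] _)]
      exact Nat.add_le_add_right (Nat.add_le_add_right this _) _
  exact of_enc_eq_comp h.fst fun a => by rw [key]; rfl

@[fun_prop]
theorem embeds {G H : α → GraphData} (hG : PolyTime G) (hH : PolyTime H) :
    PolyTime fun a => embeds (G a) (H a) := by
  unfold GraphData.embeds
  fun_prop

end PolyTime

/-! ### Decoding the input word. -/

namespace ShEx

/-- The interval of a symbol. -/
def Sym.basic? : Sym → Option Basic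
  | occ M => some M
  | _ => none

/-- The bit of a symbol. -/
def Sym.toBit : Sym → Bool
  | bit b => b
  | _ => false

/-- The state of the parser, which reads a word from the right to the left: the length of the
current block of ticks, target, interval and label of the current edge, the edges of the current
graph, and the second graph. -/
abbrev ParserState : Type := (ℕ × ℕ) × (Basic × List Bool) × List EdgeData × GraphData

/-- Read a symbol. -/
def parseStep (s : Sym) (σ : ParserState) : ParserState :=
  if s = .tick then ((σ.1.1 + 1, σ.1.2), σ.2)
  else if s = .edge then
    ((0, 0), (.one, []), ((σ.1, σ.2.1) :: σ.2.2.1, σ.2.2.2))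
  else if s = .sep then ((0, 0), (.one, []), ([], (σ.1.1, σ.2.2.1)))
  else s.basic?.elim (σ.1, (σ.2.1.1, s.toBit :: σ.2.1.2), σ.2.2)
    -- Read from the right, the ticks counted up to the interval give the target, and counting
    -- restarts for the source.
    fun M => ((0, σ.1.1), (M, σ.2.1.2), σ.2.2)

/-- The parser. -/
def parse (x : List Sym) : ParserState := x.foldr parseStep ((0, 0), (.one, []), ([], (0, [])))

/-- The code of an edge. -/
def EdgeData.encode (e : EdgeData) : List Sym :=
  .edge :: (List.replicate e.1.1 .tick ++ .occ e.2.1 ::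
    (e.2.2.map .bit ++ List.replicate e.1.2 .tick))

/-- The code of a graph. -/
def GraphData.encode (G : GraphData) : List Sym :=
  List.replicate G.1 .tick ++ G.2.flatMap EdgeData.encode

/-- The end points of the edges are nodes. -/
def GraphData.valid (G : GraphData) : Bool :=
  G.2.all fun e => decide (e.1.1 < G.1) && decide (e.1.2 < G.1)

/-- The decision procedure for the embedding problem, for the reversed word. -/
def decideEmbedding (y : List Sym) : Bool :=
  let σ := parse y.reverse
  let G : GraphData := (σ.1.1, σ.2.2.1)
  let H : GraphData := σ.2.2.2
  -- The parser never fails and returns arbitrary data on malformed words; encoding the result again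
  -- and comparing it with the input rejects these.
  decide (y = (G.encode ++ .sep :: H.encode).reverse) && (G.valid && (H.valid && embeds G H))

theorem foldr_replicate_tick (n t u : ℕ) (r : (Basic × List Bool) × List EdgeData × GraphData) :
    (List.replicate n Sym.tick).foldr parseStep ((t, u), r) = ((t + n, u), r) := by
  induction n with
  | zero => rfl
  | succ n ih => rw [List.replicate_succ, List.foldr_cons, ih]; rfl

theorem foldr_map_bit (l : List Bool) (p : ℕ × ℕ) (M : Basic)
    (r : List EdgeData × GraphData) :
    (l.map Sym.bit).foldr parseStep (p, (M, []), r) = (p, (M, l), r) := by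
  induction l with
  | nil => rfl
  | cons b l ih =>
    rw [List.map_cons, List.foldr_cons, ih]
    simp [parseStep, Sym.basic?, Sym.toBit]

theorem foldr_encode_edge (e : EdgeData) (E : List EdgeData) (H : GraphData) :
    e.encode.foldr parseStep ((0, 0), (.one, []), (E, H)) = ((0, 0), (.one, []), (e :: E, H)) := by
  obtain ⟨⟨s, t⟩, M, l⟩ := e
  have h : ∀ p r l, parseStep (.occ M) (p, (.one, l), r) = ((0, p.1), (M, l), r) := by
    simp [parseStep, Sym.basic?]
  simp only [EdgeData.encode, List.foldr_cons, List.foldr_append, foldr_replicate_tick,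
    foldr_map_bit, h, Nat.zero_add]
  rfl

theorem foldr_encode_graph (G H : GraphData) :
    G.encode.foldr parseStep ((0, 0), (.one, []), ([], H)) =
      ((G.1, 0), (.one, []), (G.2, H)) := by
  have h : ∀ E : List EdgeData, (E.flatMap EdgeData.encode).foldr parseStep
      ((0, 0), (.one, []), ([], H)) = ((0, 0), (.one, []), (E, H)) := by
    intro E
    induction E with
    | nil => rfl
    | cons e E ih => rw [List.flatMap_cons, List.foldr_append, ih, foldr_encode_edge]
  rw [GraphData.encode, List.foldr_append, h, foldr_replicate_tick, Nat.zero_add]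

/-- The parser inverts the encoding, so an encoded pair of graphs can be recovered from its word. -/
theorem parse_encode (G H : GraphData) :
    parse (G.encode ++ .sep :: H.encode) = ((G.1, 0), (.one, []), (G.2, H)) := by
  have h : ∀ p q r, parseStep .sep (p, q, r) = ((0, 0), (.one, []), ([], (p.1, r.1))) :=
    fun _ _ _ => rfl
  rw [parse, List.foldr_append, List.foldr_cons, foldr_encode_graph, h, foldr_encode_graph]

theorem ShapeGraph.encode_eq (G : ShapeGraph) : G.encode = G.data.encode := by
  simp [ShapeGraph.encode, GraphData.encode, ShapeGraph.data, List.flatMap_def, List.map_ofFn,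
    Function.comp_def, EdgeData.encode]
  congr 2
  funext e
  simp [ShapeGraph.encodeEdge]

theorem ShapeGraph.valid_data (G : ShapeGraph) : G.data.valid = true := by
  simp [GraphData.valid, ShapeGraph.data]

theorem exists_data_eq {G : GraphData} (hG : G.valid = true) : ∃ G' : ShapeGraph, G'.data = G := by
  obtain ⟨n, E⟩ := G
  simp only [GraphData.valid, List.all_eq_true, Bool.and_eq_true, decide_eq_true_eq] at hG
  refine ⟨⟨n, E.length, fun i => ⟨E[i].1.1, (hG _ (E.getElem_mem i.2)).1⟩,
    fun i => ⟨E[i].1.2, (hG _ (E.getElem_mem i.2)).2⟩, fun i => E[i].2.2, fun i => E[i].2.1⟩, ?_⟩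
  simp [ShapeGraph.data]

theorem decideEmbedding_iff (x : List Sym) :
    decideEmbedding x.reverse = true ↔ x ∈ embeddingProblem := by
  simp only [decideEmbedding, List.reverse_reverse, Bool.and_eq_true, decide_eq_true_eq,
    List.reverse_inj]
  constructor
  · rintro ⟨hx, hG, hH, he⟩
    obtain ⟨G, hG⟩ := exists_data_eq hG
    obtain ⟨H, hH⟩ := exists_data_eq hH
    rw [← hG, ← hH] at he hx
    exact ⟨G, H, by rw [hx, G.encode_eq, H.encode_eq], (G.embeds_data_iff H).1 he⟩
  · rintro ⟨G, H, rfl, he⟩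
    rw [G.encode_eq, H.encode_eq, parse_encode]
    exact ⟨rfl, G.valid_data, H.valid_data, (G.embeds_data_iff H).2 he⟩

/-- Bounded growth per symbol is what `PolyTime.foldl` asks for; the constant 30 is generous. -/
theorem sz_parseStep_le (s : Sym) (σ : ParserState) : sz (parseStep s σ) ≤ sz σ + 30 := by
  have h : ∀ M : Basic, sz M ≤ 7 := by
    intro M
    have : sz M = sz M.code := rfl
    rw [this, sz_nat]
    cases M <;> simp [Basic.code]
  obtain ⟨⟨t, u⟩, ⟨M, l⟩, E, H⟩ := σ
  have h₁ := h Basic.one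
  unfold parseStep
  split_ifs
  · simp; omega
  · simp; omega
  · simp; omega
  · cases hs : s.basic? with
    | none => have := sz_bool s.toBit; simp; omega
    | some N => have := h N; simp; omega

end ShEx

namespace PolyTime

/-- On the reversed word, which is what loading the input produces, the right-to-left parser is a
left fold. -/
theorem parse : PolyTime fun y : List Sym => parse y.reverse := by
  refine of_enc_eq_comp (foldl id (const _) (f := fun _ σ s => parseStep s σ) ?_ 30
    fun _ σ s _ => by simpa only [Polynomial.eval_ofNat] using sz_parseStep_le s σ) fun y => by
      rw [ShEx.parse, List.foldr_reverse]
  have h₁ := of_finite (α := List Sym × ParserState × Sym) id.snd.snd Sym.basic?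
  have h₂ := of_finite (α := List Sym × ParserState × Sym) id.snd.snd Sym.toBit
  unfold parseStep
  fun_prop

@[fun_prop]
theorem encodeEdge {α : Type} [Enc α] {e : α → EdgeData} (he : PolyTime e) :
    PolyTime fun a => (e a).encode := by
  have : PolyTime fun p : α × Bool => Sym.bit p.2 := of_finite id.snd _
  have : PolyTime fun a => Sym.occ (e a).2.1 := of_finite he.snd.fst _
  unfold EdgeData.encode
  fun_prop

@[fun_prop]
theorem encodeGraph {α : Type} [Enc α] {G : α → GraphData} (hG : PolyTime G) :
    PolyTime fun a => (G a).encode := by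
  unfold GraphData.encode
  fun_prop

@[fun_prop]
theorem valid {α : Type} [Enc α] {G : α → GraphData} (hG : PolyTime G) :
    PolyTime fun a => (G a).valid := by
  unfold GraphData.valid
  fun_prop

theorem decideEmbedding : PolyTime decideEmbedding := by
  unfold ShEx.decideEmbedding
  have := parse
  fun_prop

end PolyTime

theorem mainTheorem3 : ShEx.InP ShEx.embeddingProblem :=
  PolyTime.decideEmbedding.inP ShEx.decideEmbedding_iff
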